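/- **Setting.** Fix a belief model: a state $\omega$ with a density $p>0$ on a real interval $\Omega$, and, given $\omega$, signals $X_i\in\{0,\dots,m-1\}$ of the agents that are independent with a common distribution $\Pr(x\mid\omega)>0$; the posteriors $\Pr(X_j=\cdot\mid X_i=x)$ and $\Pr(X_j=\cdot\mid X_i=x')$ differ whenever $x\ne x'$. Agents arrive in groups of a fixed size $k\ge 2$, one group per period; the states of different groups are independent draws from $p$. Each agent is rational with probability $1-\epsilon\in(0,1]$ and otherwise reports a uniformly random value. An estimate $\hat\epsilon$, independent of the groups and not observed by the agents, satisfies $\mathbb E\,\hat\epsilon=\epsilon$. The peer truth serum PTS with a fully mixed distribution $P$ (and a scaling $c>0$) pays an agent $i$ of a group who reports $y$ the amount $c\,\mathbf 1_{y=z}/P(y)-c\,\hat\epsilon/(mP(y))$, where $z$ is the report of agent $(i+1)\bmod k$. It is BNIC if truthful reporting by the rational agents is a strict Bayesian-Nash equilibrium. AdaPTS has finitely many fully mixed distributions $P_1,\dots,P_K$. It uses each once, in periods $1,\dots,K$; in a period $t>K$ it uses a $P_a$ that maximizes $I_a/N_a+\sqrt{2\ln(t-1)/N_a}$ (ties are broken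 arbitrarily), where $N_a$ is the number of earlier uses of $P_a$ and $I_a$ is the sum, over these uses, of the fraction of ordered pairs of distinct agents of the group whose reports disagree. Each agent knows her signal, her period and place, and the distribution in force, and is paid by PTS with that distribution. A report is non-truthful if it is made by a rational agent and differs from her signal. **Theorem.** 1. There is $\gamma_0>0$ such that, whenever the probability simplex is divided into finitely many regions of sup-norm diameter at most $\gamma_0$ and a fully mixed representative is chosen in each, PTS is BNIC for at least one representative (whatever $c>0$ and the law of $\hat\epsilon$ with mean $\epsilon$). 2. If PTS is BNIC for at least one of $P_1,\dots,P_K$, then AdaPTS has a strict Bayesian-Nash equilibrium strategy profile in which rational agents are truthful whenever PTS with the distribution $P_a$ in force is BNIC, and otherwise report $\rho_a(X)$ for a non-surjective $\rho_a:\{0,\dots,m-1\}\to\{0,\dots,m-1\}$ that is a strict equilibrium of PTS with $P_a$, and in which the expected number of non-truthful reports among $n=kT$ agents is $O(\log n)$: it is at most $C\log n$ for all $T\ge1$, with $C$ independent of $n$. For this same profile and every $\omega\in\Omega$, the expected number of non-truthful reports is also at most $C_\omega\log n$ if all groups share the one state $\omega$. -/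

import Mathlib

open MeasureTheory ProbabilityTheory

/-- A common belief model with signals in `{0, …, m - 1}`: the state `ω` ranges over a real interval
`Ω` and has a positive density `p`; given the state, an agent's signal is `x` with probability
`lik x ω`, and this conditional distribution is fully mixed. -/
structure BeliefModel (m : ℕ) where
  Ω : Set ℝ
  interval : Ω.OrdConnected
  p : Ω → ℝ
  p_measurable : Measurable p
  p_pos : ∀ ω, 0 < p ω
  p_integral : ∫ ω, p ω ∂(volume : Measure ℝ).comap Subtype.val = 1
  lik : Fin m → Ω → ℝ
  lik_measurable : ∀ x, Measurable (lik x)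
  lik_pos : ∀ x ω, 0 < lik x ω
  lik_sum : ∀ ω, ∑ x, lik x ω = 1

namespace BeliefModel

variable {m : ℕ} (B : BeliefModel m)

/-- The law `p(ω) dω` of the state. -/
noncomputable def prior : Measure B.Ω :=
  ((volume : Measure ℝ).comap Subtype.val).withDensity (fun ω => ENNReal.ofReal (B.p ω))

instance : IsProbabilityMeasure B.prior := by
  have hint : Integrable B.p ((volume : Measure ℝ).comap Subtype.val) := by
    by_contra h
    have h1 := B.p_integral
    rw [integral_undef h] at h1
    exact zero_ne_one h1
  constructor
  rw [prior, withDensity_apply _ MeasurableSet.univ, setLIntegral_univ,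
    ← ofReal_integral_eq_lintegral_ofReal hint
      (Filter.Eventually.of_forall fun ω => (B.p_pos ω).le), B.p_integral, ENNReal.ofReal_one]

/-- The posterior probability `Pr(X_j = y | X_i = x)`. -/
noncomputable def posterior (y x : Fin m) : ℝ :=
  (∫ ω, B.lik y ω * B.lik x ω ∂B.prior) / ∫ ω, B.lik x ω ∂B.prior

/-- Distinct signals induce distinct posteriors about the signal of another agent. -/
def StochasticallyRelevant : Prop :=
  ∀ x x' : Fin m, x ≠ x' → ∃ y, B.posterior y x ≠ B.posterior y x'

end BeliefModel

/-- The primitive data of one agent: her signal, whether she is rational, and the value that she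
reports in case she is not rational. -/
abbrev AgentData (m : ℕ) := Fin m × Bool × Fin m

namespace AgentData

variable {m : ℕ}

abbrev signal (d : AgentData m) : Fin m := d.1

abbrev rational (d : AgentData m) : Bool := d.2.1

abbrev heuristic (d : AgentData m) : Fin m := d.2.2

/-- The value reported by an agent who, if rational, applies `s` to her signal. -/
def report (s : Fin m → Fin m) (d : AgentData m) : Fin m :=
  if d.rational then s d.signal else d.heuristic

end AgentData

/-- The data of the `k` agents of one group. -/
abbrev GroupData (m k : ℕ) := Fin k → AgentData m

/-- The probability of the data `d` of one agent in state `ω`: the signal, the event of being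
rational (of probability `1 - ε`), and the uniformly distributed heuristic report are
independent. -/
noncomputable def agentProb {m : ℕ} (B : BeliefModel m) (ε : Set.Ico (0 : ℝ) 1) (ω : B.Ω)
    (d : AgentData m) : ℝ :=
  B.lik d.signal ω * (if d.rational then 1 - (ε : ℝ) else (ε : ℝ)) * (1 / (m : ℝ))

/-- The law of the data of a group of `k` agents whose common state has law `q`; given the state, the
agents are independent. -/
noncomputable def groupLaw {m : ℕ} (B : BeliefModel m) (ε : Set.Ico (0 : ℝ) 1) (k : ℕ)
    (q : Measure B.Ω) : Measure (GroupData m k) :=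
  ∑ g : GroupData m k, ENNReal.ofReal (∫ ω, ∏ i, agentProb B ε ω (g i) ∂q) • Measure.dirac g

section GroupLaw

variable {m : ℕ} (B : BeliefModel m) (ε : Set.Ico (0 : ℝ) 1)

theorem agentProb_nonneg (ω : B.Ω) (d : AgentData m) : 0 ≤ agentProb B ε ω d := by
  have h0 := ε.2.1
  have h1 := ε.2.2
  unfold agentProb
  refine mul_nonneg (mul_nonneg (B.lik_pos _ _).le ?_) (by positivity)
  split_ifs <;> linarith

theorem agentProb_sum (ω : B.Ω) : ∑ d, agentProb B ε ω d = 1 := by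
  have hm : (m : ℝ) ≠ 0 := by
    rintro h
    have hm0 : m = 0 := by exact_mod_cast h
    subst hm0
    have := B.lik_sum ω
    simp at this
  simp only [agentProb, AgentData.signal, AgentData.rational]
  rw [Fintype.sum_prod_type]
  simp only [Fintype.sum_prod_type, Fintype.sum_bool, if_true, Bool.false_eq_true, if_false,
    Finset.sum_const, Finset.card_univ, Fintype.card_fin, nsmul_eq_mul]
  have : ∀ x : Fin m, (m : ℝ) * (B.lik x ω * (1 - (ε : ℝ)) * (1 / (m : ℝ)))
      + (m : ℝ) * (B.lik x ω * (ε : ℝ) * (1 / (m : ℝ))) = B.lik x ω := by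
    intro x
    field_simp
    ring
  simp only [this, B.lik_sum ω]

theorem agentProb_measurable (d : AgentData m) : Measurable fun ω => agentProb B ε ω d := by
  unfold agentProb
  exact ((B.lik_measurable _).mul_const _).mul_const _

theorem agentProb_le_one (ω : B.Ω) (d : AgentData m) : agentProb B ε ω d ≤ 1 := by
  rw [← agentProb_sum B ε ω]
  exact Finset.single_le_sum (fun d _ => agentProb_nonneg B ε ω d) (Finset.mem_univ d)

instance groupLaw_isProbabilityMeasure (k : ℕ) (q : Measure B.Ω) [IsProbabilityMeasure q] :
    IsProbabilityMeasure (groupLaw B ε k q) := by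
  have hint : ∀ g : GroupData m k, Integrable (fun ω => ∏ i, agentProb B ε ω (g i)) q := by
    intro g
    refine Integrable.of_bound (C := 1)
      (Finset.measurable_prod _ fun i _ => agentProb_measurable B ε (g i)).aestronglyMeasurable
      (Filter.Eventually.of_forall fun ω => ?_)
    rw [Real.norm_eq_abs, abs_of_nonneg (Finset.prod_nonneg fun i _ => agentProb_nonneg B ε ω _)]
    exact Finset.prod_le_one (fun i _ => agentProb_nonneg B ε ω _)
      fun i _ => agentProb_le_one B ε ω _
  constructor
  simp only [groupLaw, Measure.coe_finsetSum, Finset.sum_apply, Measure.smul_apply, measure_univ,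
    smul_eq_mul, mul_one]
  rw [← ENNReal.ofReal_sum_of_nonneg fun g _ =>
      integral_nonneg fun ω => Finset.prod_nonneg fun i _ => agentProb_nonneg B ε ω _,
    ← integral_finsetSum _ fun g _ => hint g]
  have : ∀ ω, ∑ g : GroupData m k, ∏ i, agentProb B ε ω (g i) = 1 := by
    intro ω
    rw [← Fintype.prod_sum]
    simp [agentProb_sum]
  simp [this]

end GroupLaw

/-- The peer of agent `i` is agent `(i + 1) mod k`. -/
def peer {k : ℕ} (i : Fin k) : Fin k :=
  ⟨(i.1 + 1) % k, Nat.mod_lt _ (Nat.zero_lt_of_lt i.2)⟩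

/-- The payment of the peer truth serum with distribution `P`, scaling `c` and noise estimate `e` for
reporting `y` when the peer reports `z`. -/
noncomputable def ptsPayment {m : ℕ} (c e : ℝ) (P : Fin m → ℝ) (y z : Fin m) : ℝ :=
  c * (if y = z then 1 / P y else 0) - c * (e / (m * P y))

/-- A fully mixed distribution on the signals. -/
def FullyMixed {m : ℕ} (P : Fin m → ℝ) : Prop :=
  (∀ x, 0 < P x) ∧ ∑ x, P x = 1

/-- The strategy profile in which every rational agent with signal `x` reports `ρ x` is a strict
Bayesian-Nash equilibrium of the peer truth serum with distribution `P`, played by one group of `k`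
agents. The noise estimate has law `ν`, independent of the group. -/
def IsStrictPTSEquilibrium {m : ℕ} (B : BeliefModel m) (ε : Set.Ico (0 : ℝ) 1) (k : ℕ)
    (ν : Measure ℝ) (c : ℝ) (P : Fin m → ℝ) (ρ : Fin m → Fin m) : Prop :=
  ∀ (i : Fin k) (x y : Fin m), y ≠ ρ x →
    ∫ w, ptsPayment c w.2 P y ((w.1 (peer i)).report ρ)
        ∂ProbabilityTheory.cond ((groupLaw B ε k B.prior).prod ν) {w | (w.1 i).signal = x} <
      ∫ w, ptsPayment c w.2 P (ρ x) ((w.1 (peer i)).report ρ)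
        ∂ProbabilityTheory.cond ((groupLaw B ε k B.prior).prod ν) {w | (w.1 i).signal = x}

/-- The peer truth serum with distribution `P` is strictly Bayesian-Nash incentive compatible. -/
def IsBNIC {m : ℕ} (B : BeliefModel m) (ε : Set.Ico (0 : ℝ) 1) (k : ℕ)
    (ν : Measure ℝ) (c : ℝ) (P : Fin m → ℝ) : Prop :=
  IsStrictPTSEquilibrium B ε k ν c P id

/-- `RP` is a discretization of the probability simplex with granularity `γ`: the simplex is divided
into regions of (sup norm) diameter at most `γ`, each with a fully mixed representative. -/
def IsDiscretization {m K : ℕ} (γ : ℝ) (RP : Fin K → Fin m → ℝ) : Prop :=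
  ∃ R : Fin K → Set (Fin m → ℝ), (⋃ j, R j) = stdSimplex ℝ (Fin m) ∧
    ∀ j, RP j ∈ R j ∧ FullyMixed (RP j) ∧ ∀ P ∈ R j, ∀ Q ∈ R j, ∀ x, |P x - Q x| ≤ γ

/-- The fraction of ordered pairs of distinct agents of the group whose reports disagree. -/
noncomputable def disagreement {m k : ℕ} (Y : Fin k → Fin m) : ℝ :=
  1 / ((k : ℝ) * ((k : ℝ) - 1)) *
    ∑ i, ∑ j ∈ Finset.univ.erase i, if Y i ≠ Y j then (1 : ℝ) else 0

/-- The data of the AdaPTS mechanism with `K` representative distributions: the representatives, the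
scaling, and a rule that picks a maximizer (ties are broken in an arbitrary way). -/
structure AdaPTS (m K : ℕ) where
  RP : Fin K → Fin m → ℝ
  fullyMixed : ∀ a, FullyMixed (RP a)
  c : ℝ
  c_pos : 0 < c
  argmax : (Fin K → ℝ) → Fin K
  le_argmax : ∀ (f : Fin K → ℝ) (a : Fin K), f a ≤ f (argmax f)

/-- A (pure) strategy profile: the agent at place `i` of the group of period `t`, if rational, reports
`σ t i a x` when the `a`-th representative distribution is in force and her signal is `x`. -/
abbrev StrategyProfile (m k K : ℕ) := ℕ → Fin k → Fin K → Fin m → Fin m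

namespace AdaPTS

variable {m k K : ℕ} (M : AdaPTS m K) (σ : StrategyProfile m k K)

/-- The UCB1 choice in period `t` (periods are counted from `0`, so that `t` periods have passed),
when `I a` is the total disagreement collected by the representative `a` in its `N a` uses. -/
noncomputable def choice (t : ℕ) (S : (Fin K → ℝ) × (Fin K → ℕ)) : Fin K :=
  if h : t < K then ⟨t, h⟩
  else M.argmax fun a => S.1 a / S.2 a + Real.sqrt (2 * Real.log t / S.2 a)

/-- The total disagreements and the numbers of uses of the representatives before period `t`, for the
sequence `w` of groups. -/
noncomputable def stats (w : ℕ → GroupData m k) : ℕ → (Fin K → ℝ) × (Fin K → ℕ)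
  | 0 => (0, 0)
  | t + 1 =>
    let S := stats w t
    let a := M.choice t S
    (Function.update S.1 a (S.1 a + disagreement fun i => (w t i).report (σ t i a)),
      Function.update S.2 a (S.2 a + 1))

/-- The index of the representative distribution that is in force in period `t`. -/
noncomputable def arm (w : ℕ → GroupData m k) (t : ℕ) : Fin K :=
  M.choice t (M.stats σ w t)

/-- The report of agent `i` in period `t`. -/
noncomputable def reports (w : ℕ → GroupData m k) (t : ℕ) (i : Fin k) : Fin m :=
  (w t i).report (σ t i (M.arm σ w t))

/-- The payment to agent `i` of period `t` if she reports `y`, when the noise estimate is `e`. -/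
noncomputable def payment (w : ℕ → GroupData m k) (e : ℝ) (t : ℕ) (i : Fin k) (y : Fin m) : ℝ :=
  ptsPayment M.c e (M.RP (M.arm σ w t)) y (M.reports σ w t (peer i))

/-- The law of a run of the mechanism: the groups are independent with states of law `q`, and the
noise estimate has law `ν` and is independent of them. -/
noncomputable def runLaw (B : BeliefModel m) (ε : Set.Ico (0 : ℝ) 1) (k : ℕ) (q : Measure B.Ω)
    [IsProbabilityMeasure q] (ν : Measure ℝ) : Measure ((ℕ → GroupData m k) × ℝ) :=
  (Measure.infinitePi fun _ : ℕ => groupLaw B ε k q).prod ν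

/-- `σ` is a strict Bayesian-Nash equilibrium of the mechanism: whatever distribution in force (that
has positive probability in her period) and signal an agent faces, the report that `σ` prescribes
gives her a strictly larger conditional expected payment than every other report. -/
def IsStrictEquilibrium (B : BeliefModel m) (ε : Set.Ico (0 : ℝ) 1) (ν : Measure ℝ) : Prop :=
  ∀ (t : ℕ) (i : Fin k) (a : Fin K) (x : Fin m),
    runLaw B ε k B.prior ν {r | M.arm σ r.1 t = a ∧ (r.1 t i).signal = x} ≠ 0 →
    ∀ y, y ≠ σ t i a x →
      ∫ r, M.payment σ r.1 r.2 t i y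
          ∂ProbabilityTheory.cond (runLaw B ε k B.prior ν) {r | M.arm σ r.1 t = a ∧ (r.1 t i).signal = x} <
        ∫ r, M.payment σ r.1 r.2 t i (σ t i a x)
          ∂ProbabilityTheory.cond (runLaw B ε k B.prior ν) {r | M.arm σ r.1 t = a ∧ (r.1 t i).signal = x}

/-- The number of non-truthful reports, i.e. reports of rational agents that differ from their
signals, in the first `T` periods. -/
noncomputable def numNonTruthful (w : ℕ → GroupData m k) (T : ℕ) : ℕ :=
  ∑ t ∈ Finset.range T,
    (Finset.univ.filter fun i : Fin k =>
      (w t i).rational = true ∧ M.reports σ w t i ≠ (w t i).signal).card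

/-- The expected number of non-truthful reports among the `k * T` agents of the first `T` periods. -/
noncomputable def expectedNonTruthful (B : BeliefModel m) (ε : Set.Ico (0 : ℝ) 1) (q : Measure B.Ω)
    [IsProbabilityMeasure q] (ν : Measure ℝ) (T : ℕ) : ℝ :=
  ∫ r, (M.numNonTruthful σ r.1 T : ℝ) ∂runLaw B ε k q ν

/-- Agents are truthful whenever the peer truth serum with the distribution in force is BNIC, and
otherwise they play a strict equilibrium of it that is given by a non-surjective function. -/
def TruthfulOrNonSurjective (B : BeliefModel m) (ε : Set.Ico (0 : ℝ) 1) (ν : Measure ℝ) : Prop :=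
  ∀ a : Fin K,
    (IsBNIC B ε k ν M.c (M.RP a) → ∀ t i, σ t i a = id) ∧
    (¬ IsBNIC B ε k ν M.c (M.RP a) → ∃ ρ : Fin m → Fin m, ¬ Function.Surjective ρ ∧
      IsStrictPTSEquilibrium B ε k ν M.c (M.RP a) ρ ∧ ∀ t i, σ t i a = ρ)

end AdaPTS

/-!
The expected payment of the peer truth serum for reporting `y` on the signal `x`, when the peer
applies `ρ`, is a positive factor that does not depend on `y` times `Pr(ρ X_j = y, X_i = x) / P y`:
the subtracted noise term cancels the matches with heuristic reports in expectation
(`integral_ptsPayment`). Two strict equilibria follow.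

* Truth-telling is strict for `P` proportional to `x ↦ √Pr(X_i = x, X_j = x)`. This is the strict
  Cauchy-Schwarz inequality for the likelihoods, where equality would make two signals induce the
  same posterior (`BeliefModel.joint_lt`). The condition is open in `P`, so that a fine enough
  discretization contains an incentive compatible representative (`exists_granularity`).
* A constant report is strict for every fully mixed `P`, since no other report is ever matched by a
  rational peer (`isStrictPTSEquilibrium_const`).

The profile for the adaptive mechanism is truthful where the serum is incentive compatible and
constant elsewhere. The distribution in force is a function of the earlier groups only, so an agent
who conditions on it and on her signal faces a single play of the serum (`map_cond_runLaw`), and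
the profile is a strict equilibrium.

Whatever the law of the state, a group with constant reports has a strictly smaller expected
disagreement than a truthful group (`integral_groupDisagreement_const_lt`). Hence the untruthful
distributions are suboptimal arms of a stochastic bandit on which the mechanism runs UCB1, and each
is used `O(log T)` times in expectation (`AdaPTS.integral_occurrences_le`). The concentration
inequality needed for the random number of uses comes from the exponential supermartingale
`exp (λ S_n - λ² N_n / 8)` (`integral_exp_collected_le_one`), with a union bound over the values of
`N_n`.
-/

/-! ### The law of a group -/

section GroupLawIntegrals

variable {m k : ℕ} (B : BeliefModel m) (ε : Set.Ico (0 : ℝ) 1)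

theorem BeliefModel.lik_le_one (x : Fin m) (ω : B.Ω) : B.lik x ω ≤ 1 := by
  rw [← B.lik_sum ω]
  exact Finset.single_le_sum (fun d _ => (B.lik_pos d ω).le) (Finset.mem_univ x)

theorem BeliefModel.integrable_lik (q : Measure B.Ω) [IsProbabilityMeasure q] (x : Fin m) :
    Integrable (B.lik x) q :=
  Integrable.of_mem_Icc 0 1 (B.lik_measurable x).aemeasurable
    (.of_forall fun ω => ⟨(B.lik_pos x ω).le, B.lik_le_one x ω⟩)

theorem BeliefModel.integrable_lik_mul (q : Measure B.Ω) [IsProbabilityMeasure q] (x y : Fin m) :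
    Integrable (fun ω => B.lik x ω * B.lik y ω) q :=
  Integrable.of_mem_Icc 0 1 ((B.lik_measurable x).mul (B.lik_measurable y)).aemeasurable
    (.of_forall fun ω => ⟨(mul_pos (B.lik_pos x ω) (B.lik_pos y ω)).le,
      mul_le_one₀ (B.lik_le_one x ω) (B.lik_pos y ω).le (B.lik_le_one y ω)⟩)

/-- A pointwise positive integrable function has a positive integral against a probability
measure. -/
theorem integral_pos_of_forall_pos {α : Type*} [MeasurableSpace α] {μ : Measure α}
    [IsProbabilityMeasure μ] {f : α → ℝ} (hf : ∀ x, 0 < f x) (hi : Integrable f μ) :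
    0 < ∫ x, f x ∂μ := by
  rw [integral_pos_iff_support_of_nonneg (fun x => (hf x).le) hi]
  have : Function.support f = Set.univ := by
    ext x; simp [(hf x).ne']
  simp [this]

theorem integrable_prod_agentProb (q : Measure B.Ω) [IsProbabilityMeasure q]
    (g : GroupData m k) : Integrable (fun ω => ∏ i, agentProb B ε ω (g i)) q :=
  Integrable.of_mem_Icc 0 1
    (Finset.measurable_prod _ fun i _ => agentProb_measurable B ε (g i)).aemeasurable
    (.of_forall fun ω => ⟨Finset.prod_nonneg fun _ _ => agentProb_nonneg B ε ω _,
      Finset.prod_le_one (fun _ _ => agentProb_nonneg B ε ω _)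
        fun _ _ => agentProb_le_one B ε ω _⟩)

theorem integral_groupLaw (q : Measure B.Ω) [IsProbabilityMeasure q] (F : GroupData m k → ℝ) :
    ∫ g, F g ∂groupLaw B ε k q = ∫ ω, ∑ g, (∏ i, agentProb B ε ω (g i)) * F g ∂q := by
  rw [groupLaw, integral_finsetSum_measure fun g _ =>
      (integrable_dirac (by simp)).smul_measure ENNReal.ofReal_ne_top,
    integral_finsetSum _ fun g _ => (integrable_prod_agentProb B ε q g).mul_const _]
  refine Finset.sum_congr rfl fun g _ => ?_
  rw [integral_smul_measure, integral_dirac, integral_mul_const, smul_eq_mul,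
    ENNReal.toReal_ofReal (integral_nonneg fun ω =>
      Finset.prod_nonneg fun i _ => agentProb_nonneg B ε ω _)]

/-- Given the state, the data of two distinct agents are independent. -/
theorem sum_prod_agentProb_mul (ω : B.Ω) {i j : Fin k} (hij : i ≠ j) (φ ψ : AgentData m → ℝ) :
    ∑ g : GroupData m k, (∏ l, agentProb B ε ω (g l)) * (φ (g i) * ψ (g j)) =
      (∑ d, agentProb B ε ω d * φ d) * ∑ d, agentProb B ε ω d * ψ d := by
  have h1 : ∀ g : GroupData m k, (∏ l, agentProb B ε ω (g l)) * (φ (g i) * ψ (g j)) =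
      ∏ l, agentProb B ε ω (g l) *
        ((if l = i then φ (g l) else 1) * (if l = j then ψ (g l) else 1)) := by
    intro g
    rw [Finset.prod_mul_distrib, Finset.prod_mul_distrib]
    simp
  simp_rw [h1]
  rw [← Fintype.prod_sum (fun l d => agentProb B ε ω d *
        ((if l = i then φ d else 1) * (if l = j then ψ d else 1)))]
  have h2 : ∀ l : Fin k, ∑ d, agentProb B ε ω d *
        ((if l = i then φ d else 1) * (if l = j then ψ d else 1)) =
      (if l = i then ∑ d, agentProb B ε ω d * φ d else 1) *
        (if l = j then ∑ d, agentProb B ε ω d * ψ d else 1) := by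
    intro l
    by_cases hi : l = i
    · have hj : l ≠ j := fun h => hij (hi.symm.trans h)
      simp [hi, hij]
    · by_cases hj : l = j
      · simp [hj, hij.symm]
      · simp [hi, hj, agentProb_sum]
  simp_rw [h2, Finset.prod_mul_distrib]
  simp

/-- The probability, in state `ω`, that a signal is mapped to `z` by `ρ`. -/
noncomputable def BeliefModel.likMap (ρ : Fin m → Fin m) (z : Fin m) (ω : B.Ω) : ℝ :=
  ∑ s, if ρ s = z then B.lik s ω else 0

/-- The probability, in state `ω`, that an agent who applies `ρ` if she is rational reports `z`. -/
noncomputable def reportProb (ρ : Fin m → Fin m) (z : Fin m) (ω : B.Ω) : ℝ :=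
  (1 - ε) * B.likMap ρ z ω + ε / m

theorem BeliefModel.signals_pos (ω : B.Ω) : 0 < m := by
  rcases Nat.eq_zero_or_pos m with h | h
  · subst h
    simpa using B.lik_sum ω
  · exact h

theorem sum_agentProb_report (ρ : Fin m → Fin m) (z : Fin m) (ω : B.Ω) :
    ∑ d, agentProb B ε ω d * (if AgentData.report ρ d = z then 1 else 0) =
      reportProb B ε ρ z ω := by
  have hm : (m : ℝ) ≠ 0 := by exact_mod_cast (B.signals_pos ω).ne'
  have key : ∀ x : Fin m, ∑ b : Bool, ∑ h : Fin m, agentProb B ε ω (x, b, h) *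
      (if AgentData.report ρ (x, b, h) = z then 1 else 0) =
      (1 - ε) * (if ρ x = z then B.lik x ω else 0) + ε / m * B.lik x ω := by
    intro x
    simp only [agentProb, AgentData.report, AgentData.signal, AgentData.rational,
      AgentData.heuristic, Fintype.sum_bool, if_true, Bool.false_eq_true, if_false,
      Finset.sum_const, Finset.card_univ, Fintype.card_fin, nsmul_eq_mul, mul_ite, mul_one,
      mul_zero, Finset.sum_ite_eq', Finset.mem_univ]
    split_ifs
    · field_simp
    · field_simp
  simp only [Fintype.sum_prod_type]
  rw [Finset.sum_congr rfl fun x _ => key x, Finset.sum_add_distrib, ← Finset.mul_sum,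
    ← Finset.mul_sum, B.lik_sum ω, mul_one, reportProb, BeliefModel.likMap]

theorem sum_agentProb_signal (x : Fin m) (ω : B.Ω) :
    ∑ d : AgentData m, agentProb B ε ω d * (if d.signal = x then 1 else 0) = B.lik x ω := by
  have hm : (m : ℝ) ≠ 0 := by exact_mod_cast (B.signals_pos ω).ne'
  have key : ∀ s : Fin m, ∑ b : Bool, ∑ h : Fin m, agentProb B ε ω (s, b, h) *
      (if AgentData.signal (s, b, h) = x then 1 else 0) = if s = x then B.lik s ω else 0 := by
    intro s
    simp only [agentProb, AgentData.signal, AgentData.rational,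
      Fintype.sum_bool, if_true, Bool.false_eq_true, if_false,
      Finset.sum_const, Finset.card_univ, Fintype.card_fin, nsmul_eq_mul, mul_ite, mul_one,
      mul_zero]
    split_ifs
    · field_simp
      ring
    · simp
  simp only [Fintype.sum_prod_type]
  rw [Finset.sum_congr rfl fun x _ => key x]
  simp

theorem BeliefModel.likMap_nonneg (ρ : Fin m → Fin m) (z : Fin m) (ω : B.Ω) :
    0 ≤ B.likMap ρ z ω :=
  Finset.sum_nonneg fun s _ => by split_ifs <;> simp [(B.lik_pos s ω).le]

theorem BeliefModel.sum_likMap (ρ : Fin m → Fin m) (ω : B.Ω) : ∑ z, B.likMap ρ z ω = 1 := by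
  simp only [BeliefModel.likMap]
  rw [Finset.sum_comm]
  simp [B.lik_sum]

theorem BeliefModel.likMap_le_one (ρ : Fin m → Fin m) (z : Fin m) (ω : B.Ω) :
    B.likMap ρ z ω ≤ 1 := by
  rw [← B.sum_likMap ρ ω]
  exact Finset.single_le_sum (fun d _ => B.likMap_nonneg ρ d ω) (Finset.mem_univ z)

theorem BeliefModel.likMap_measurable (ρ : Fin m → Fin m) (z : Fin m) :
    Measurable (B.likMap ρ z) :=
  Finset.measurable_sum _ fun s _ => by
    split_ifs
    · exact B.lik_measurable s
    · exact measurable_const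

theorem BeliefModel.likMap_id (z : Fin m) : B.likMap id z = B.lik z := by
  ext ω
  simp [BeliefModel.likMap]

theorem BeliefModel.likMap_const (z₀ z : Fin m) (ω : B.Ω) :
    B.likMap (fun _ => z₀) z ω = if z₀ = z then 1 else 0 := by
  simp only [BeliefModel.likMap]
  split_ifs
  · exact B.lik_sum ω
  · simp

theorem BeliefModel.integrable_lik_mul_likMap (q : Measure B.Ω) [IsProbabilityMeasure q]
    (x : Fin m) (ρ : Fin m → Fin m) (z : Fin m) :
    Integrable (fun ω => B.lik x ω * B.likMap ρ z ω) q :=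
  Integrable.of_mem_Icc 0 1 ((B.lik_measurable x).mul (B.likMap_measurable ρ z)).aemeasurable
    (.of_forall fun ω => ⟨mul_nonneg (B.lik_pos x ω).le (B.likMap_nonneg ρ z ω),
      mul_le_one₀ (B.lik_le_one x ω) (B.likMap_nonneg ρ z ω) (B.likMap_le_one ρ z ω)⟩)

end GroupLawIntegrals

/-! ### Expected payments of the peer truth serum -/

section PTS

variable {m k : ℕ} (B : BeliefModel m) (ε : Set.Ico (0 : ℝ) 1)

theorem peer_ne (hk : 2 ≤ k) (i : Fin k) : i ≠ peer i := by
  intro h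
  have h1 : i.1 = (i.1 + 1) % k := congrArg Fin.val h
  have h2 := i.2
  rcases Nat.lt_or_ge (i.1 + 1) k with h3 | h3
  · rw [Nat.mod_eq_of_lt h3] at h1
    omega
  · have h4 : i.1 + 1 = k := by omega
    rw [h4, Nat.mod_self] at h1
    omega

theorem measureReal_groupLaw_signal (hk : 2 ≤ k) (q : Measure B.Ω) [IsProbabilityMeasure q]
    (i : Fin k) (x : Fin m) :
    (groupLaw B ε k q).real {g | (g i).signal = x} = ∫ ω, B.lik x ω ∂q := by
  rw [← integral_indicator_one (Set.toFinite _).measurableSet, integral_groupLaw]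
  congr 1
  ext ω
  have := sum_prod_agentProb_mul B ε ω (peer_ne hk i)
    (fun d => if d.signal = x then 1 else 0) (fun _ => 1)
  simp only [mul_one, agentProb_sum, sum_agentProb_signal] at this
  rw [← this]
  simp [Set.indicator_apply]

theorem integral_groupLaw_signal_report (q : Measure B.Ω) [IsProbabilityMeasure q]
    {i j : Fin k} (hij : i ≠ j) (x : Fin m) (ρ : Fin m → Fin m) (y : Fin m) :
    ∫ g in {g | (g i).signal = x}, (if y = (g j).report ρ then 1 else 0) ∂groupLaw B ε k q =
      ∫ ω, B.lik x ω * reportProb B ε ρ y ω ∂q := by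
  rw [← integral_indicator (Set.toFinite _).measurableSet, integral_groupLaw]
  congr 1
  ext ω
  have := sum_prod_agentProb_mul B ε ω hij
    (fun d => if d.signal = x then 1 else 0) (fun d => if d.report ρ = y then 1 else 0)
  simp only [sum_agentProb_report, sum_agentProb_signal] at this
  rw [← this]
  refine Finset.sum_congr rfl fun g _ => ?_
  simp [Set.indicator_apply, ← ite_and, eq_comm, and_comm]

theorem cond_prod_fst {α β : Type*} [MeasurableSpace α] [MeasurableSpace β] (μ : Measure α)
    (ν : Measure β) [IsFiniteMeasure μ] [IsProbabilityMeasure ν] (s : Set α) :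
    ProbabilityTheory.cond (μ.prod ν) {w | w.1 ∈ s} = (ProbabilityTheory.cond μ s).prod ν := by
  have h : {w : α × β | w.1 ∈ s} = s ×ˢ Set.univ := by ext; simp
  rw [h, ProbabilityTheory.cond, ProbabilityTheory.cond, Measure.prod_smul_left,
    ← Measure.prod_restrict, Measure.restrict_univ, Measure.prod_prod, measure_univ, mul_one]

/-- The subtracted term `c e / (m P y)` makes up, in expectation, exactly for the matches with
heuristic reports, so only the rational peers matter. -/
theorem integral_ptsPayment (hk : 2 ≤ k) {ν : Measure ℝ} [IsProbabilityMeasure ν]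
    (hν : Integrable id ν) (hmean : ∫ e, e ∂ν = (ε : ℝ)) (c : ℝ) (P : Fin m → ℝ)
    (ρ : Fin m → Fin m) (i : Fin k) (x y : Fin m) :
    ∫ w, ptsPayment c w.2 P y ((w.1 (peer i)).report ρ)
        ∂ProbabilityTheory.cond ((groupLaw B ε k B.prior).prod ν) {w | (w.1 i).signal = x} =
      c * (1 - ε) / (∫ ω, B.lik x ω ∂B.prior) *
        ((∫ ω, B.lik x ω * B.likMap ρ y ω ∂B.prior) / P y) := by
  have hπ : 0 < ∫ ω, B.lik x ω ∂B.prior :=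
    integral_pos_of_forall_pos (B.lik_pos x) (B.integrable_lik B.prior x)
  set γ := groupLaw B ε k B.prior with hγ
  set S : Set (GroupData m k) := {g | (g i).signal = x} with hS
  have hreal : γ.real S = ∫ ω, B.lik x ω ∂B.prior := measureReal_groupLaw_signal B ε hk B.prior i x
  have hne : γ S ≠ 0 := by
    intro h
    rw [Measure.real, h] at hreal
    simp only [ENNReal.toReal_zero] at hreal
    exact hπ.ne hreal
  have := cond_isProbabilityMeasure hne
  have hcond : ProbabilityTheory.cond (γ.prod ν) {w | (w.1 i).signal = x} =
      (ProbabilityTheory.cond γ S).prod ν := cond_prod_fst γ ν S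
  rw [hcond]
  simp only [ptsPayment]
  have i1 : Integrable (fun w : GroupData m k × ℝ =>
      c * if y = (w.1 (peer i)).report ρ then 1 / P y else 0)
      ((ProbabilityTheory.cond γ S).prod ν) :=
    Integrable.comp_fst (f := fun g : GroupData m k =>
      c * if y = (g (peer i)).report ρ then 1 / P y else 0) Integrable.of_finite ν
  have hν' : Integrable (fun e => c * (e / (m * P y))) ν := (hν.div_const _).const_mul _
  have i2 : Integrable (fun w : GroupData m k × ℝ => c * (w.2 / (m * P y)))
      ((ProbabilityTheory.cond γ S).prod ν) := hν'.comp_snd _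
  rw [integral_sub i1 i2, integral_fun_snd (fun e => c * (e / (m * P y))),
    integral_fun_fst (fun g : GroupData m k =>
      c * if y = (g (peer i)).report ρ then 1 / P y else 0)]
  have e1 : ∀ g : GroupData m k, (c * if y = (g (peer i)).report ρ then 1 / P y else 0) =
      c / P y * if y = (g (peer i)).report ρ then 1 else 0 := by
    intro g; split_ifs <;> ring
  have hrep : ∫ ω, B.lik x ω * reportProb B ε ρ y ω ∂B.prior =
      (1 - ε) * (∫ ω, B.lik x ω * B.likMap ρ y ω ∂B.prior) +
        ε / m * ∫ ω, B.lik x ω ∂B.prior := by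
    rw [← integral_const_mul, ← integral_const_mul,
      ← integral_add ((B.integrable_lik_mul_likMap _ x ρ y).const_mul _)
        ((B.integrable_lik _ x).const_mul _)]
    congr 1
    ext ω
    simp only [reportProb]
    ring
  have e2 : ∫ g, (if y = (g (peer i)).report ρ then 1 else 0) ∂ProbabilityTheory.cond γ S =
      (∫ ω, B.lik x ω ∂B.prior)⁻¹ * ((1 - ε) * (∫ ω, B.lik x ω * B.likMap ρ y ω ∂B.prior) +
        ε / m * ∫ ω, B.lik x ω ∂B.prior) := by
    rw [ProbabilityTheory.cond, integral_smul_measure, ENNReal.toReal_inv, smul_eq_mul, ← hrep,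
      ← integral_groupLaw_signal_report B ε B.prior (peer_ne hk i) x ρ y, ← hreal]
    rfl
  simp only [e1]
  rw [integral_const_mul, integral_const_mul, integral_div, hmean, e2]
  simp only [probReal_univ, one_smul]
  field_simp
  ring

/-- The criterion behind all incentive properties of the peer truth serum: the signal `x` must make
the prescribed report `ρ x` the strict maximizer of `Pr(ρ X_j = y, X_i = x) / P y`. -/
theorem isStrictPTSEquilibrium_of_lt (hk : 2 ≤ k) {ν : Measure ℝ} [IsProbabilityMeasure ν]
    (hν : Integrable id ν) (hmean : ∫ e, e ∂ν = (ε : ℝ)) {c : ℝ} (hc : 0 < c) {P : Fin m → ℝ}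
    {ρ : Fin m → Fin m}
    (h : ∀ x y, y ≠ ρ x → (∫ ω, B.lik x ω * B.likMap ρ y ω ∂B.prior) / P y <
      (∫ ω, B.lik x ω * B.likMap ρ (ρ x) ω ∂B.prior) / P (ρ x)) :
    IsStrictPTSEquilibrium B ε k ν c P ρ := by
  intro i x y hy
  rw [integral_ptsPayment B ε hk hν hmean, integral_ptsPayment B ε hk hν hmean]
  have hπ : 0 < ∫ ω, B.lik x ω ∂B.prior :=
    integral_pos_of_forall_pos (B.lik_pos x) (B.integrable_lik B.prior x)
  have hε : 0 < 1 - (ε : ℝ) := sub_pos.2 ε.2.2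
  exact mul_lt_mul_of_pos_left (h x y hy) (by positivity)

/-- If all rational agents report `z`, only the report `z` has a positive expected payment. -/
theorem isStrictPTSEquilibrium_const (hk : 2 ≤ k) {ν : Measure ℝ} [IsProbabilityMeasure ν]
    (hν : Integrable id ν) (hmean : ∫ e, e ∂ν = (ε : ℝ)) {c : ℝ} (hc : 0 < c) {P : Fin m → ℝ}
    (hP : FullyMixed P) (z : Fin m) :
    IsStrictPTSEquilibrium B ε k ν c P (fun _ => z) := by
  refine isStrictPTSEquilibrium_of_lt B ε hk hν hmean hc fun x y hy => ?_
  simp only [BeliefModel.likMap_const, if_neg (Ne.symm hy), mul_zero, integral_zero, zero_div,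
    if_true, mul_one]
  exact div_pos (integral_pos_of_forall_pos (B.lik_pos x) (B.integrable_lik B.prior x)) (hP.1 z)

end PTS

/-! ### Distributions for which the peer truth serum is incentive compatible -/

section BNIC

variable {m k : ℕ} (B : BeliefModel m) (ε : Set.Ico (0 : ℝ) 1)

/-- The probability that two given agents of a group have the signals `y` and `x`. -/
noncomputable def BeliefModel.joint (y x : Fin m) : ℝ :=
  ∫ ω, B.lik y ω * B.lik x ω ∂B.prior

theorem BeliefModel.joint_pos (y x : Fin m) : 0 < B.joint y x :=
  integral_pos_of_forall_pos (fun ω => mul_pos (B.lik_pos y ω) (B.lik_pos x ω))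
    (B.integrable_lik_mul B.prior y x)

/-- The strict Cauchy-Schwarz inequality: equality would make the likelihoods of `x` and `y`
proportional, and then `x` and `y` would induce the same posterior. -/
theorem BeliefModel.joint_lt (hB : B.StochasticallyRelevant) {x y : Fin m} (hxy : x ≠ y) :
    B.joint y x < √(B.joint x x) * √(B.joint y y) := by
  set a := √(B.joint x x) with ha
  set b := √(B.joint y y) with hb
  have hapos : 0 < a := Real.sqrt_pos.2 (B.joint_pos x x)
  have hbpos : 0 < b := Real.sqrt_pos.2 (B.joint_pos y y)
  have ha2 : B.joint x x = a ^ 2 := (Real.sq_sqrt (B.joint_pos x x).le).symm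
  have hb2 : B.joint y y = b ^ 2 := (Real.sq_sqrt (B.joint_pos y y).le).symm
  have hexp : ∀ ω, (b * B.lik x ω - a * B.lik y ω) ^ 2 =
      b ^ 2 * (B.lik x ω * B.lik x ω) + a ^ 2 * (B.lik y ω * B.lik y ω)
        - 2 * a * b * (B.lik y ω * B.lik x ω) := fun ω => by ring
  have i1 := (B.integrable_lik_mul B.prior x x).const_mul (b ^ 2)
  have i2 := (B.integrable_lik_mul B.prior y y).const_mul (a ^ 2)
  have i3 := (B.integrable_lik_mul B.prior y x).const_mul (2 * a * b)
  have i12 : Integrable (fun ω => b ^ 2 * (B.lik x ω * B.lik x ω) +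
    a ^ 2 * (B.lik y ω * B.lik y ω)) B.prior := i1.add i2
  have hint : ∫ ω, (b * B.lik x ω - a * B.lik y ω) ^ 2 ∂B.prior =
      2 * a * b * (a * b - B.joint y x) := by
    simp_rw [hexp]
    rw [integral_sub i12 i3, integral_add i1 i2, integral_const_mul, integral_const_mul,
      integral_const_mul]
    change b ^ 2 * B.joint x x + a ^ 2 * B.joint y y - 2 * a * b * B.joint y x = _
    rw [ha2, hb2]
    ring
  have hnn : 0 ≤ ∫ ω, (b * B.lik x ω - a * B.lik y ω) ^ 2 ∂B.prior :=
    integral_nonneg fun ω => sq_nonneg _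
  have hle : 0 ≤ a * b - B.joint y x := by
    rw [hint] at hnn
    exact nonneg_of_mul_nonneg_right hnn (by positivity)
  refine lt_of_le_of_ne (by linarith) fun heq => ?_
  have hzero : ∫ ω, (b * B.lik x ω - a * B.lik y ω) ^ 2 ∂B.prior = 0 := by
    rw [hint, heq]; ring
  have hisq : Integrable (fun ω => (b * B.lik x ω - a * B.lik y ω) ^ 2) B.prior := by
    simp_rw [hexp]
    exact i12.sub i3
  rw [integral_eq_zero_iff_of_nonneg (fun ω => sq_nonneg _) hisq] at hzero
  have hprop : ∀ᵐ ω ∂B.prior, B.lik x ω = a / b * B.lik y ω := by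
    filter_upwards [hzero] with ω hω
    have h0 : b * B.lik x ω - a * B.lik y ω = 0 := by simpa using hω
    field_simp
    linarith
  obtain ⟨z, hz⟩ := hB x y hxy
  apply hz
  have h1 : ∫ ω, B.lik z ω * B.lik x ω ∂B.prior =
      a / b * ∫ ω, B.lik z ω * B.lik y ω ∂B.prior := by
    rw [← integral_const_mul]
    refine integral_congr_ae ?_
    filter_upwards [hprop] with ω hω
    rw [hω]; ring
  have h2 : ∫ ω, B.lik x ω ∂B.prior = a / b * ∫ ω, B.lik y ω ∂B.prior := by
    rw [← integral_const_mul]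
    exact integral_congr_ae hprop
  rw [BeliefModel.posterior, BeliefModel.posterior, h1, h2,
    mul_div_mul_left _ _ (by positivity)]

theorem isBNIC_of_lt (hk : 2 ≤ k) {ν : Measure ℝ} [IsProbabilityMeasure ν]
    (hν : Integrable id ν) (hmean : ∫ e, e ∂ν = (ε : ℝ)) {c : ℝ} (hc : 0 < c) {P : Fin m → ℝ}
    (hP : FullyMixed P) (h : ∀ x y, y ≠ x → B.joint y x * P x < B.joint x x * P y) :
    IsBNIC B ε k ν c P := by
  refine isStrictPTSEquilibrium_of_lt B ε hk hν hmean hc fun x y hy => ?_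
  simp only [BeliefModel.likMap_id, id]
  rw [div_lt_div_iff₀ (hP.1 y) (hP.1 x)]
  have := h x y hy
  simpa only [BeliefModel.joint, mul_comm (B.lik x _)] using this

/-- The distribution proportional to `x ↦ √(Pr(X_i = x, X_j = x))` is incentive compatible by the
strict Cauchy-Schwarz inequality, hence so are all fully mixed distributions close to it. -/
theorem exists_granularity (hk : 2 ≤ k) (hB : B.StochasticallyRelevant) :
    ∃ γ₀ : ℝ, 0 < γ₀ ∧ ∀ (K : ℕ) (RP : Fin K → Fin m → ℝ), IsDiscretization γ₀ RP →
      ∃ a : Fin K, ∀ (ν : Measure ℝ) [IsProbabilityMeasure ν] (c : ℝ), Integrable id ν →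
        ∫ e, e ∂ν = (ε : ℝ) → 0 < c → IsBNIC B ε k ν c (RP a) := by
  obtain ⟨ω₀⟩ : Nonempty B.Ω := nonempty_of_isProbabilityMeasure B.prior
  have : Nonempty (Fin m) := ⟨⟨0, B.signals_pos ω₀⟩⟩
  set s : ℝ := ∑ x, √(B.joint x x) with hs
  have hspos : 0 < s := Finset.sum_pos (fun x _ => Real.sqrt_pos.2 (B.joint_pos x x))
    Finset.univ_nonempty
  set P₀ : Fin m → ℝ := fun x => √(B.joint x x) / s with hP₀
  have hmem : P₀ ∈ stdSimplex ℝ (Fin m) :=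
    ⟨fun x => by positivity, by rw [← Finset.sum_div, div_self hspos.ne']⟩
  have hopen : IsOpen {P : Fin m → ℝ |
      ∀ x y, y ≠ x → B.joint y x * P x < B.joint x x * P y} := by
    simp only [Set.ofPred_forall]
    refine isOpen_iInter_of_finite fun x => isOpen_iInter_of_finite fun y =>
      isOpen_iInter_of_finite fun _ => ?_
    exact isOpen_lt (by fun_prop) (by fun_prop)
  have hin : P₀ ∈ {P : Fin m → ℝ |
      ∀ x y, y ≠ x → B.joint y x * P x < B.joint x x * P y} := by
    intro x y hyx
    have h := B.joint_lt hB hyx.symm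
    have hx : 0 < √(B.joint x x) := Real.sqrt_pos.2 (B.joint_pos x x)
    have hx2 : B.joint x x = √(B.joint x x) * √(B.joint x x) :=
      (Real.mul_self_sqrt (B.joint_pos x x).le).symm
    simp only [hP₀]
    rw [mul_div_assoc', mul_div_assoc']
    refine div_lt_div_of_pos_right ?_ hspos
    calc B.joint y x * √(B.joint x x)
        < √(B.joint x x) * √(B.joint y y) * √(B.joint x x) := mul_lt_mul_of_pos_right h hx
      _ = B.joint x x * √(B.joint y y) := by
          conv_rhs => rw [hx2]
          ring
  obtain ⟨δ, hδ, hball⟩ := Metric.isOpen_iff.1 hopen P₀ hin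
  refine ⟨δ / 2, by positivity, fun K RP ⟨R, hR, hRP⟩ => ?_⟩
  rw [← hR, Set.mem_iUnion] at hmem
  obtain ⟨a, ha⟩ := hmem
  refine ⟨a, fun ν _ c hν hmean hc => ?_⟩
  obtain ⟨h1, h2, h3⟩ := hRP a
  refine isBNIC_of_lt B ε hk hν hmean hc h2 (hball ?_)
  have : dist (RP a) P₀ ≤ δ / 2 := by
    rw [dist_pi_le_iff (by positivity)]
    intro x
    rw [Real.dist_eq]
    exact h3 _ h1 _ ha x
  exact lt_of_le_of_lt this (by linarith)

end BNIC

/-! ### Functions of finitely many of a sequence of independent variables -/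

section IID

variable {G : Type*}

theorem DependsOn.exists_comp_restrict_range [Nonempty G] {β : Type*} {F : (ℕ → G) → β} {n : ℕ}
    (hF : DependsOn F (Set.Iio n)) :
    ∃ F' : (Finset.range n → G) → β, F = F' ∘ (Finset.range n).restrict := by
  classical
  refine ⟨fun h => F fun i => if hi : i ∈ Finset.range n then h ⟨i, hi⟩ else Classical.arbitrary G,
    funext fun w => hF fun i hi => ?_⟩
  have : i ∈ Finset.range n := Finset.mem_range.2 hi
  simp [this]

theorem DependsOn.mono_Iio {β : Type*} {F : (ℕ → G) → β} {n n' : ℕ} (h : n ≤ n')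
    (hF : DependsOn F (Set.Iio n)) : DependsOn F (Set.Iio n') :=
  fun _ _ hw => hF fun i hi => hw i (lt_of_lt_of_le hi h)

theorem indepFun_restrict_range_eval [MeasurableSpace G] (γ : Measure G)
    [IsProbabilityMeasure γ] (n : ℕ) :
    IndepFun (Finset.range n).restrict (fun w : ℕ → G => w n)
      (Measure.infinitePi fun _ : ℕ => γ) := by
  have h := (iIndepFun_infinitePi (P := fun _ : ℕ => γ) (X := fun _ w => w)
    (fun _ => measurable_id)).indepFun_finset (Finset.range n) {n} (by simp)
    (fun i => measurable_pi_apply i)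
  exact h.comp (φ := id) (ψ := fun v : ({n} : Finset ℕ) → G => v ⟨n, Finset.mem_singleton_self n⟩)
    measurable_id (measurable_pi_apply _)

variable [MeasurableSpace G] [Finite G] [MeasurableSingletonClass G]

theorem DependsOn.measurable_of_Iio [Nonempty G] {β : Type*} [MeasurableSpace β]
    {F : (ℕ → G) → β} {n : ℕ} (hF : DependsOn F (Set.Iio n)) : Measurable F := by
  obtain ⟨F', rfl⟩ := hF.exists_comp_restrict_range
  exact (measurable_of_finite F').comp (Finset.measurable_restrict _)

variable (γ : Measure G) [IsProbabilityMeasure γ]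

theorem DependsOn.integrable_infinitePi {F : (ℕ → G) → ℝ} {n : ℕ}
    (hF : DependsOn F (Set.Iio n)) : Integrable F (Measure.infinitePi fun _ : ℕ => γ) := by
  have : Nonempty G := nonempty_of_isProbabilityMeasure γ
  obtain ⟨F', rfl⟩ := hF.exists_comp_restrict_range
  have : IsProbabilityMeasure ((Measure.infinitePi fun _ : ℕ => γ).map (Finset.range n).restrict) :=
    Measure.isProbabilityMeasure_map (Finset.measurable_restrict _).aemeasurable
  exact Integrable.comp_measurable Integrable.of_finite (Finset.measurable_restrict _)

theorem DependsOn.indepFun_eval {β : Type*} [MeasurableSpace β] {F : (ℕ → G) → β} {n : ℕ}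
    (hF : DependsOn F (Set.Iio n)) :
    IndepFun F (fun w : ℕ → G => w n) (Measure.infinitePi fun _ : ℕ => γ) := by
  have : Nonempty G := nonempty_of_isProbabilityMeasure γ
  obtain ⟨F', rfl⟩ := hF.exists_comp_restrict_range
  exact (indepFun_restrict_range_eval γ n).comp (measurable_of_finite F') measurable_id

/-- The coordinate `w n` may be integrated out first in a function of `w n` and of the earlier
coordinates. -/
theorem integral_infinitePi_eq_integral_integral {H : (ℕ → G) → G → ℝ} {n : ℕ}
    (hH : DependsOn H (Set.Iio n)) :
    ∫ w, H w (w n) ∂(Measure.infinitePi fun _ : ℕ => γ) =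
      ∫ w, ∫ g, H w g ∂γ ∂(Measure.infinitePi fun _ : ℕ => γ) := by
  have : Nonempty G := nonempty_of_isProbabilityMeasure γ
  obtain ⟨H', rfl⟩ := hH.exists_comp_restrict_range
  set μ := Measure.infinitePi fun _ : ℕ => γ with hμ
  have hX : Measurable ((Finset.range n).restrict : (ℕ → G) → _) := Finset.measurable_restrict _
  have hY : Measurable (fun w : ℕ → G => w n) := measurable_pi_apply n
  have hmap : μ.map (fun w => ((Finset.range n).restrict w, w n)) =
      (μ.map (Finset.range n).restrict).prod γ := by
    rw [(indepFun_restrict_range_eval γ n).map_prod_eq_prod_map_map hX.aemeasurable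
      hY.aemeasurable, Measure.infinitePi_map_eval]
  have : IsProbabilityMeasure (μ.map (Finset.range n).restrict) :=
    Measure.isProbabilityMeasure_map hX.aemeasurable
  calc ∫ w, (H' ∘ (Finset.range n).restrict) w (w n) ∂μ
      = ∫ p, H' p.1 p.2 ∂μ.map (fun w => ((Finset.range n).restrict w, w n)) := by
        rw [integral_map (hX.prodMk hY).aemeasurable
          (measurable_of_finite _).aestronglyMeasurable]
        rfl
    _ = ∫ v, ∫ g, H' v g ∂γ ∂μ.map (Finset.range n).restrict := by
        rw [hmap, integral_prod _ Integrable.of_finite]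
    _ = _ := by
        rw [integral_map hX.aemeasurable (measurable_of_finite _).aestronglyMeasurable]
        rfl

end IID

/-! ### Concentration of sums over predictable times -/

section Concentration

variable {G : Type*}

/-- The number of times before `n` at which the event `A` occurs. -/
noncomputable def occurrences (A : ℕ → (ℕ → G) → Prop) (n : ℕ) (w : ℕ → G) : ℕ :=
  open scoped Classical in ∑ s ∈ Finset.range n, if A s w then 1 else 0

/-- The sum of `f (w s)` over the times `s < n` at which the event `A` occurs. -/
noncomputable def collected (A : ℕ → (ℕ → G) → Prop) (f : G → ℝ) (n : ℕ) (w : ℕ → G) : ℝ :=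
  open scoped Classical in ∑ s ∈ Finset.range n, if A s w then f (w s) else 0

variable {A : ℕ → (ℕ → G) → Prop}

theorem dependsOn_occurrences (hA : ∀ s, DependsOn (A s) (Set.Iio s)) (n : ℕ) :
    DependsOn (occurrences A n) (Set.Iio n) := by
  intro w w' h
  refine Finset.sum_congr rfl fun s hs => ?_
  have hs' := Finset.mem_range.1 hs
  rw [(hA s).mono_Iio hs'.le h]

theorem dependsOn_collected (hA : ∀ s, DependsOn (A s) (Set.Iio s)) (f : G → ℝ) (n : ℕ) :
    DependsOn (collected A f n) (Set.Iio n) := by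
  intro w w' h
  refine Finset.sum_congr rfl fun s hs => ?_
  have hs' := Finset.mem_range.1 hs
  rw [(hA s).mono_Iio hs'.le h, h s hs']

theorem occurrences_le (n : ℕ) (w : ℕ → G) : occurrences A n w ≤ n := by
  classical
  calc occurrences A n w ≤ ∑ _s ∈ Finset.range n, 1 :=
        Finset.sum_le_sum fun s _ => by split_ifs <;> simp
    _ = n := by simp

theorem collected_sub_const (f : G → ℝ) (r : ℝ) (n : ℕ) (w : ℕ → G) :
    collected A (fun g => f g - r) n w = collected A f n w - occurrences A n w * r := by
  classical
  rw [collected, collected, occurrences, Nat.cast_sum, Finset.sum_mul, ← Finset.sum_sub_distrib]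
  refine Finset.sum_congr rfl fun s _ => ?_
  split_ifs <;> simp

theorem collected_neg (f : G → ℝ) (n : ℕ) (w : ℕ → G) :
    collected A (fun g => -f g) n w = -collected A f n w := by
  classical
  rw [collected, collected, ← Finset.sum_neg_distrib]
  refine Finset.sum_congr rfl fun s _ => ?_
  split_ifs <;> simp

variable [MeasurableSpace G] [Finite G] [MeasurableSingletonClass G] (γ : Measure G)
  [IsProbabilityMeasure γ]

/-- By Hoeffding's lemma, `exp (λ S_n - λ² N_n / 8)` is a supermartingale, where `S_n` collects a
centred variable with values in an interval of length `1` at `N_n` predictable times. -/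
theorem integral_exp_collected_le_one (hA : ∀ s, DependsOn (A s) (Set.Iio s)) {f : G → ℝ} {a : ℝ}
    (hf : ∀ g, f g ∈ Set.Icc a (a + 1)) (hmean : ∫ g, f g ∂γ = 0) (l : ℝ) (n : ℕ) :
    ∫ w, Real.exp (l * collected A f n w - l ^ 2 / 8 * occurrences A n w)
      ∂(Measure.infinitePi fun _ : ℕ => γ) ≤ 1 := by
  classical
  induction n with
  | zero => simp [collected, occurrences]
  | succ n ih =>
    refine le_trans ?_ ih
    set E : (ℕ → G) → ℝ := fun w =>
      Real.exp (l * collected A f n w - l ^ 2 / 8 * occurrences A n w) with hE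
    have hEdep : DependsOn E (Set.Iio n) := by
      intro w w' h
      simp only [hE]
      rw [dependsOn_collected hA f n h, dependsOn_occurrences hA n h]
    set H : (ℕ → G) → G → ℝ := fun w g =>
      E w * if A n w then Real.exp (l * f g) * Real.exp (-(l ^ 2 / 8)) else 1 with hH
    have hHdep : DependsOn H (Set.Iio n) := by
      intro w w' h
      simp only [hH]
      rw [hEdep h, hA n h]
    have hstep : ∀ w, Real.exp (l * collected A f (n + 1) w
        - l ^ 2 / 8 * occurrences A (n + 1) w) = H w (w n) := by
      intro w
      simp only [hH, hE, collected, occurrences, Finset.sum_range_succ]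
      split_ifs
      · rw [← Real.exp_add, ← Real.exp_add]
        congr 1
        push_cast
        ring
      · simp
    simp_rw [hstep]
    rw [integral_infinitePi_eq_integral_integral γ hHdep]
    have hdep2 : DependsOn (fun w => ∫ g, H w g ∂γ) (Set.Iio n) := by
      intro w w' h
      simp only [hHdep h]
    refine integral_mono (hdep2.integrable_infinitePi γ) (hEdep.integrable_infinitePi γ) fun w => ?_
    have hEpos : 0 < E w := Real.exp_pos _
    have hmgf : ∫ g, Real.exp (l * f g) ∂γ ≤ Real.exp (l ^ 2 / 8) := by
      have h := (hasSubgaussianMGF_of_mem_Icc_of_integral_eq_zero (μ := γ) (X := f)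
        (measurable_of_finite f).aemeasurable (.of_forall hf) hmean).mgf_le l
      rw [mgf] at h
      refine h.trans (Real.exp_le_exp.2 (le_of_eq ?_))
      simp
      ring
    simp only [hH]
    rw [integral_const_mul]
    refine mul_le_of_le_one_right hEpos.le ?_
    split_ifs
    · rw [integral_mul_const]
      calc _ ≤ Real.exp (l ^ 2 / 8) * Real.exp (-(l ^ 2 / 8)) :=
            mul_le_mul_of_nonneg_right hmgf (Real.exp_pos _).le
        _ = 1 := by rw [← Real.exp_add]; simp
    · simp

/-- Hoeffding's inequality for the sum over the first `j` of a sequence of predictable times. -/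
theorem measureReal_collected_ge_le (hA : ∀ s, DependsOn (A s) (Set.Iio s)) {f : G → ℝ} {a : ℝ}
    (hf : ∀ g, f g ∈ Set.Icc a (a + 1)) (hmean : ∫ g, f g ∂γ = 0) (n : ℕ) {j : ℕ} (hj : 0 < j)
    {u : ℝ} (hu : 0 ≤ u) :
    (Measure.infinitePi fun _ : ℕ => γ).real
      {w | occurrences A n w = j ∧ u ≤ collected A f n w} ≤ Real.exp (-(2 * u ^ 2 / j)) := by
  have hj' : (0 : ℝ) < j := by exact_mod_cast hj
  set μ := Measure.infinitePi fun _ : ℕ => γ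
  -- the value of the parameter that optimizes the Chernoff bound
  set l : ℝ := 4 * u / j with hl
  set E : (ℕ → G) → ℝ := fun w =>
    Real.exp (l * collected A f n w - l ^ 2 / 8 * occurrences A n w) with hE
  have hEint : Integrable E μ := by
    refine DependsOn.integrable_infinitePi γ (n := n) fun w w' h => ?_
    simp only [hE]
    rw [dependsOn_collected hA f n h, dependsOn_occurrences hA n h]
  have hmarkov := mul_meas_ge_le_integral_of_nonneg (μ := μ) (f := E)
    (.of_forall fun w => (Real.exp_pos _).le) hEint (Real.exp (2 * u ^ 2 / j))
  have hsub : {w | occurrences A n w = j ∧ u ≤ collected A f n w} ⊆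
      {w | Real.exp (2 * u ^ 2 / j) ≤ E w} := by
    rintro w ⟨h1, h2⟩
    refine Real.exp_le_exp.2 ?_
    rw [h1]
    have h3 : l * u ≤ l * collected A f n w := mul_le_mul_of_nonneg_left h2 (by positivity)
    have h4 : l * u - l ^ 2 / 8 * j = 2 * u ^ 2 / j := by
      rw [hl]; field_simp; ring
    linarith
  have hle := measureReal_mono (μ := μ) hsub
  have h1 : Real.exp (2 * u ^ 2 / j) * μ.real {w | Real.exp (2 * u ^ 2 / j) ≤ E w} ≤ 1 :=
    hmarkov.trans (integral_exp_collected_le_one γ hA hf hmean l n)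
  rw [Real.exp_neg]
  refine hle.trans ?_
  rw [← one_div, le_div_iff₀ (Real.exp_pos _), mul_comm]
  exact h1

/-- The event that the average of the first samples exceeds the mean by the confidence radius of
UCB1 has a summable probability. The number of samples is random, and a union bound over its values
is taken. -/
theorem measureReal_deviation_le (hA : ∀ s, DependsOn (A s) (Set.Iio s)) {f : G → ℝ} {a : ℝ}
    (hf : ∀ g, f g ∈ Set.Icc a (a + 1)) (hmean : ∫ g, f g ∂γ = 0) (n : ℕ) :
    (Measure.infinitePi fun _ : ℕ => γ).real
      {w | 0 < occurrences A n w ∧ occurrences A n w *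
        √(2 * Real.log n / occurrences A n w) ≤ collected A f n w} ≤ 1 / (n : ℝ) ^ 3 := by
  set μ := Measure.infinitePi fun _ : ℕ => γ
  rcases Nat.eq_zero_or_pos n with rfl | hn
  · simp [occurrences]
  have hn' : (0 : ℝ) < n := by exact_mod_cast hn
  have hlog : 0 ≤ Real.log n := Real.log_natCast_nonneg n
  have hsub : {w | 0 < occurrences A n w ∧ occurrences A n w *
        √(2 * Real.log n / occurrences A n w) ≤ collected A f n w} ⊆
      ⋃ j ∈ Finset.Icc 1 n, {w | occurrences A n w = j ∧
        j * √(2 * Real.log n / j) ≤ collected A f n w} := by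
    rintro w ⟨h1, h2⟩
    simp only [Set.mem_iUnion]
    exact ⟨occurrences A n w, Finset.mem_Icc.2 ⟨h1, occurrences_le n w⟩, rfl, h2⟩
  calc _ ≤ μ.real (⋃ j ∈ Finset.Icc 1 n, {w | occurrences A n w = j ∧
        j * √(2 * Real.log n / j) ≤ collected A f n w}) :=
        measureReal_mono hsub (measure_ne_top _ _)
    _ ≤ ∑ j ∈ Finset.Icc 1 n, μ.real {w | occurrences A n w = j ∧
        j * √(2 * Real.log n / j) ≤ collected A f n w} := measureReal_biUnion_finset_le _ _
    _ ≤ ∑ j ∈ Finset.Icc 1 n, 1 / (n : ℝ) ^ 4 := by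
        refine Finset.sum_le_sum fun j hj => ?_
        have hj0 : 0 < j := (Finset.mem_Icc.1 hj).1
        have hj' : (0 : ℝ) < j := by exact_mod_cast hj0
        refine (measureReal_collected_ge_le γ hA hf hmean n hj0 (by positivity)).trans
          (le_of_eq ?_)
        rw [mul_pow, Real.sq_sqrt (by positivity)]
        have : -(2 * ((j : ℝ) ^ 2 * (2 * Real.log n / j)) / j) = -(4 * Real.log n) := by
          field_simp
          ring
        rw [this, Real.exp_neg, mul_comm, Real.exp_mul, Real.exp_log hn', one_div]
        norm_num
    _ = 1 / (n : ℝ) ^ 3 := by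
        rw [Finset.sum_const, Nat.card_Icc, nsmul_eq_mul]
        simp only [Nat.add_sub_cancel]
        field_simp

end Concentration

/-! ### Disagreement within a group -/

section Disagreement

variable {m k : ℕ}

/-- The disagreement in a group whose rational agents apply `ρ`. -/
noncomputable def groupDisagreement (ρ : Fin m → Fin m) (g : GroupData m k) : ℝ :=
  disagreement fun i => (g i).report ρ

theorem disagreement_nonneg (hk : 2 ≤ k) (Y : Fin k → Fin m) : 0 ≤ disagreement Y := by
  have hk' : (2 : ℝ) ≤ k := by exact_mod_cast hk
  have : 0 ≤ (k : ℝ) * ((k : ℝ) - 1) := mul_nonneg (by linarith) (by linarith)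
  refine mul_nonneg (by positivity) (Finset.sum_nonneg fun i _ => Finset.sum_nonneg fun j _ => ?_)
  split_ifs <;> simp

theorem sum_sum_erase_const (r : ℝ) (hk : 2 ≤ k) :
    ∑ i : Fin k, ∑ _j ∈ Finset.univ.erase i, r = (k : ℝ) * ((k : ℝ) - 1) * r := by
  have h1 : 1 ≤ k := by omega
  simp only [Finset.sum_const, Finset.card_erase_of_mem (Finset.mem_univ _), Finset.card_univ,
    Fintype.card_fin, nsmul_eq_mul, Nat.cast_sub h1, Nat.cast_one]
  ring

theorem disagreement_le_one (hk : 2 ≤ k) (Y : Fin k → Fin m) : disagreement Y ≤ 1 := by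
  have hk' : (2 : ℝ) ≤ k := by exact_mod_cast hk
  have hpos : 0 < (k : ℝ) * ((k : ℝ) - 1) := mul_pos (by linarith) (by linarith)
  rw [disagreement, one_div, inv_mul_le_iff₀ hpos, ← sum_sum_erase_const 1 hk]
  refine Finset.sum_le_sum fun i _ => Finset.sum_le_sum fun j _ => ?_
  split_ifs <;> simp

variable (B : BeliefModel m) (ε : Set.Ico (0 : ℝ) 1)

/-- Two agents of a group agree with probability `∑ z, Pr(report z) ^ 2`. -/
theorem integral_report_ne (q : Measure B.Ω) [IsProbabilityMeasure q] (ρ : Fin m → Fin m)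
    {i j : Fin k} (hij : i ≠ j) :
    ∫ g, (if (g i).report ρ ≠ (g j).report ρ then (1 : ℝ) else 0) ∂groupLaw B ε k q =
      ∫ ω, 1 - ∑ z, reportProb B ε ρ z ω ^ 2 ∂q := by
  rw [integral_groupLaw]
  congr 1
  ext ω
  have h1 : ∀ g : GroupData m k,
      (if (g i).report ρ ≠ (g j).report ρ then (1 : ℝ) else 0) =
        1 - ∑ z, (if (g i).report ρ = z then 1 else 0) * (if (g j).report ρ = z then 1 else 0) := by
    intro g
    simp only [ite_mul, one_mul, zero_mul, Finset.sum_ite_eq, Finset.mem_univ, if_true]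
    by_cases h : (g i).report ρ = (g j).report ρ
    · simp [h]
    · simp [h, Ne.symm h]
  have htot := sum_prod_agentProb_mul B ε ω hij (fun _ => 1) (fun _ => 1)
  simp only [mul_one, agentProb_sum] at htot
  simp only [h1, mul_sub, mul_one, Finset.sum_sub_distrib, htot, Finset.mul_sum]
  rw [Finset.sum_comm]
  congr 1
  refine Finset.sum_congr rfl fun z _ => ?_
  rw [sum_prod_agentProb_mul B ε ω hij (fun d => if d.report ρ = z then 1 else 0)
    (fun d => if d.report ρ = z then 1 else 0), sum_agentProb_report, sq]

theorem integral_groupDisagreement (hk : 2 ≤ k) (q : Measure B.Ω) [IsProbabilityMeasure q]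
    (ρ : Fin m → Fin m) :
    ∫ g, groupDisagreement ρ g ∂groupLaw B ε k q = ∫ ω, 1 - ∑ z, reportProb B ε ρ z ω ^ 2 ∂q := by
  have hk' : (2 : ℝ) ≤ k := by exact_mod_cast hk
  have hpos : 0 < (k : ℝ) * ((k : ℝ) - 1) := mul_pos (by linarith) (by linarith)
  simp only [groupDisagreement, disagreement]
  rw [integral_const_mul, integral_finsetSum _ fun i _ => Integrable.of_finite]
  have h : ∀ i : Fin k, ∫ g, ∑ j ∈ Finset.univ.erase i,
      (if AgentData.report ρ (g i) ≠ AgentData.report ρ (g j) then (1 : ℝ) else 0)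
        ∂groupLaw B ε k q =
      ∑ _j ∈ Finset.univ.erase i, ∫ ω, 1 - ∑ z, reportProb B ε ρ z ω ^ 2 ∂q := by
    intro i
    rw [integral_finsetSum _ fun i _ => Integrable.of_finite]
    exact Finset.sum_congr rfl fun j hj =>
      integral_report_ne B ε q ρ (Finset.ne_of_mem_erase hj).symm
  rw [Finset.sum_congr rfl fun i _ => h i, sum_sum_erase_const _ hk, ← mul_assoc,
    one_div, inv_mul_cancel₀ hpos.ne', one_mul]

/-- The heuristic reports add the same amount to the expected disagreement for every `ρ`. -/
theorem integral_groupDisagreement_eq (hk : 2 ≤ k) (q : Measure B.Ω) [IsProbabilityMeasure q]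
    (ρ : Fin m → Fin m) :
    ∫ g, groupDisagreement ρ g ∂groupLaw B ε k q =
      (1 - 2 * (1 - ε) * (ε / m) - m * (ε / m : ℝ) ^ 2)
        - (1 - (ε : ℝ)) ^ 2 * ∫ ω, ∑ z, B.likMap ρ z ω ^ 2 ∂q := by
  rw [integral_groupDisagreement B ε hk]
  have h : ∀ ω, 1 - ∑ z, reportProb B ε ρ z ω ^ 2 =
      (1 - 2 * (1 - ε) * (ε / m) - m * (ε / m : ℝ) ^ 2)
        - (1 - (ε : ℝ)) ^ 2 * ∑ z, B.likMap ρ z ω ^ 2 := by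
    intro ω
    have hz : ∀ z, reportProb B ε ρ z ω ^ 2 = (1 - (ε : ℝ)) ^ 2 * B.likMap ρ z ω ^ 2 +
        2 * (1 - ε) * (ε / m) * B.likMap ρ z ω + (ε / m : ℝ) ^ 2 := by
      intro z
      rw [reportProb]
      ring
    simp only [hz, Finset.sum_add_distrib, ← Finset.mul_sum, B.sum_likMap, Finset.sum_const,
      Finset.card_univ, Fintype.card_fin, nsmul_eq_mul]
    ring
  have hint : Integrable (fun ω => ∑ z, B.likMap ρ z ω ^ 2) q :=
    integrable_finsetSum _ fun z _ => Integrable.of_mem_Icc 0 1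
      ((B.likMap_measurable ρ z).pow_const 2).aemeasurable
      (.of_forall fun ω => ⟨sq_nonneg _, pow_le_one₀ (B.likMap_nonneg ρ z ω)
        (B.likMap_le_one ρ z ω)⟩)
  simp_rw [h]
  rw [integral_sub (integrable_const _) (hint.const_mul _), integral_const_mul]
  simp

/-- Uninformative reports disagree less than truthful ones, whatever the law of the state. -/
theorem integral_groupDisagreement_const_lt (hk : 2 ≤ k) (hm : 2 ≤ m) (q : Measure B.Ω)
    [IsProbabilityMeasure q] (z₀ : Fin m) :
    ∫ g, groupDisagreement (fun _ => z₀) g ∂groupLaw B ε k q <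
      ∫ g, groupDisagreement id g ∂groupLaw B ε k q := by
  rw [integral_groupDisagreement_eq B ε hk, integral_groupDisagreement_eq B ε hk]
  have hε : 0 < 1 - (ε : ℝ) := sub_pos.2 ε.2.2
  have hconst : ∫ ω, ∑ z, B.likMap (fun _ => z₀) z ω ^ 2 ∂q = 1 := by
    simp [BeliefModel.likMap_const]
  have hlt : ∀ x ω, B.lik x ω < 1 := by
    intro x ω
    have : Nontrivial (Fin m) := Fin.nontrivial_iff_two_le.2 hm
    obtain ⟨y, hy⟩ := exists_ne x
    rw [← B.lik_sum ω]
    exact Finset.single_lt_sum hy (Finset.mem_univ x) (Finset.mem_univ y) (B.lik_pos y ω)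
      fun d _ _ => (B.lik_pos d ω).le
  have hint : Integrable (fun ω => ∑ z, B.lik z ω ^ 2) q :=
    integrable_finsetSum _ fun z _ => by simpa only [sq] using B.integrable_lik_mul q z z
  have hpos : 0 < ∫ ω, 1 - ∑ z, B.lik z ω ^ 2 ∂q := by
    refine integral_pos_of_forall_pos (fun ω => ?_) ((integrable_const _).sub hint)
    rw [sub_pos, ← B.lik_sum ω]
    refine Finset.sum_lt_sum_of_nonempty ⟨z₀, Finset.mem_univ z₀⟩ fun x _ => ?_
    rw [sq]
    exact mul_lt_of_lt_one_right (B.lik_pos x ω) (hlt x ω)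
  rw [integral_sub (integrable_const _) hint] at hpos
  simp only [integral_const, probReal_univ, one_smul] at hpos
  rw [hconst]
  simp only [BeliefModel.likMap_id]
  have := mul_lt_mul_of_pos_left (sub_pos.1 hpos) (pow_pos hε 2)
  linarith

end Disagreement

/-! ### Incentives in the adaptive mechanism -/

namespace AdaPTS

variable {m k K : ℕ} (M : AdaPTS m K) (σ : StrategyProfile m k K)

theorem dependsOn_stats (t : ℕ) : DependsOn (fun w => M.stats σ w t) (Set.Iio t) := by
  induction t with
  | zero => exact fun _ _ _ => rfl
  | succ t ih =>
    intro w w' h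
    have h1 : M.stats σ w t = M.stats σ w' t := ih.mono_Iio t.le_succ h
    have h2 : w t = w' t := h t (Nat.lt_succ_self t)
    simp only [stats, h1, h2]

theorem dependsOn_arm (t : ℕ) : DependsOn (fun w => M.arm σ w t) (Set.Iio t) := by
  intro w w' h
  have h1 : M.stats σ w t = M.stats σ w' t := M.dependsOn_stats σ t h
  simp only [arm, h1]

variable (B : BeliefModel m) (ε : Set.Ico (0 : ℝ) 1) (ν : Measure ℝ) [IsProbabilityMeasure ν]

theorem runLaw_arm_inter (q : Measure B.Ω) [IsProbabilityMeasure q] (t : ℕ) (a : Fin K)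
    {s : Set (GroupData m k × ℝ)} (hs : MeasurableSet s) :
    runLaw B ε k q ν {r | M.arm σ r.1 t = a ∧ (r.1 t, r.2) ∈ s} =
      (Measure.infinitePi fun _ : ℕ => groupLaw B ε k q) {w | M.arm σ w t = a} *
        ((groupLaw B ε k q).prod ν) s := by
  have : Nonempty (GroupData m k) := nonempty_of_isProbabilityMeasure (groupLaw B ε k q)
  set γ := groupLaw B ε k q
  set μ := Measure.infinitePi fun _ : ℕ => γ
  have hdep := M.dependsOn_arm σ t
  have harm : Measurable fun w : ℕ → GroupData m k => M.arm σ w t := hdep.measurable_of_Iio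
  have heval : Measurable fun w : ℕ → GroupData m k => w t := measurable_pi_apply t
  have hpair := (hdep.indepFun_eval γ).map_prod_eq_prod_map_map harm.aemeasurable
    heval.aemeasurable
  rw [Measure.infinitePi_map_eval] at hpair
  have hmap : Measure.map (fun r : (ℕ → GroupData m k) × ℝ => (M.arm σ r.1 t, (r.1 t, r.2)))
      (μ.prod ν) = (μ.map fun w => M.arm σ w t).prod (γ.prod ν) := by
    have : IsProbabilityMeasure (μ.map fun w => M.arm σ w t) :=
      Measure.isProbabilityMeasure_map harm.aemeasurable
    rw [← Measure.prodAssoc_prod, ← hpair]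
    have h := Measure.map_prod_map μ ν (harm.prodMk heval) measurable_id
    rw [Measure.map_id] at h
    rw [h, Measure.map_map MeasurableEquiv.prodAssoc.measurable
      ((harm.prodMk heval).prodMap measurable_id)]
    rfl
  have hset : {r : (ℕ → GroupData m k) × ℝ | M.arm σ r.1 t = a ∧ (r.1 t, r.2) ∈ s} =
      (fun r => (M.arm σ r.1 t, (r.1 t, r.2))) ⁻¹' ({a} ×ˢ s) := by
    ext r; simp
  have hmeas : Measurable fun r : (ℕ → GroupData m k) × ℝ => (M.arm σ r.1 t, (r.1 t, r.2)) :=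
    (harm.comp measurable_fst).prodMk ((heval.comp measurable_fst).prodMk measurable_snd)
  rw [hset, runLaw, ← Measure.map_apply hmeas ((measurableSet_singleton a).prod hs), hmap,
    Measure.prod_prod, Measure.map_apply harm (measurableSet_singleton a)]
  rfl

/-- Given her signal and the distribution in force, an agent has the same belief about her group as
in a single play of the peer truth serum, since that distribution depends on earlier groups only. -/
theorem map_cond_runLaw (q : Measure B.Ω) [IsProbabilityMeasure q] (t : ℕ) (i : Fin k)
    (a : Fin K) (x : Fin m)
    (h : runLaw B ε k q ν {r | M.arm σ r.1 t = a ∧ (r.1 t i).signal = x} ≠ 0) :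
    Measure.map (fun r => (r.1 t, r.2)) (ProbabilityTheory.cond (runLaw B ε k q ν)
        {r | M.arm σ r.1 t = a ∧ (r.1 t i).signal = x}) =
      ProbabilityTheory.cond ((groupLaw B ε k q).prod ν) {w | (w.1 i).signal = x} := by
  have : Nonempty (GroupData m k) := nonempty_of_isProbabilityMeasure (groupLaw B ε k q)
  have harm : Measurable fun w : ℕ → GroupData m k => M.arm σ w t :=
    (M.dependsOn_arm σ t).measurable_of_Iio
  have heval : Measurable fun w : ℕ → GroupData m k => w t := measurable_pi_apply t
  have hY : Measurable fun r : (ℕ → GroupData m k) × ℝ => (r.1 t, r.2) :=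
    (heval.comp measurable_fst).prodMk measurable_snd
  have hS : MeasurableSet {w : GroupData m k × ℝ | (w.1 i).signal = x} :=
    measurable_fst (Set.toFinite {g : GroupData m k | (g i).signal = x}).measurableSet
  have hA : MeasurableSet {r : (ℕ → GroupData m k) × ℝ |
      M.arm σ r.1 t = a ∧ (r.1 t i).signal = x} :=
    ((harm.comp measurable_fst) (measurableSet_singleton a)).inter (hY hS)
  have e1 := M.runLaw_arm_inter σ B ε ν q t a hS
  have e1' : runLaw B ε k q ν {r | M.arm σ r.1 t = a ∧ (r.1 t i).signal = x} = _ := e1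
  have h0 : (Measure.infinitePi fun _ : ℕ => groupLaw B ε k q) {w | M.arm σ w t = a} ≠ 0 := by
    intro h0
    rw [e1', h0, zero_mul] at h
    exact h rfl
  ext s hs
  have e2 := M.runLaw_arm_inter σ B ε ν q t a (hS.inter hs)
  have hinter : {r : (ℕ → GroupData m k) × ℝ | M.arm σ r.1 t = a ∧ (r.1 t i).signal = x} ∩
      (fun r => (r.1 t, r.2)) ⁻¹' s = {r | M.arm σ r.1 t = a ∧
        (r.1 t, r.2) ∈ {w : GroupData m k × ℝ | (w.1 i).signal = x} ∩ s} := by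
    ext r
    simp [and_assoc]
  rw [Measure.map_apply hY hs, cond_apply hA, cond_apply hS, hinter, e1', e2,
    ENNReal.mul_inv (.inl h0) (.inl (measure_ne_top _ _)), mul_mul_mul_comm,
    ENNReal.inv_mul_cancel h0 (measure_ne_top _ _), one_mul]

/-- Playing, for each distribution, a strict equilibrium of the peer truth serum with it is a strict
equilibrium of the adaptive mechanism. -/
theorem isStrictEquilibrium_of_forall (ρ : Fin K → Fin m → Fin m)
    (hρ : ∀ a, IsStrictPTSEquilibrium B ε k ν M.c (M.RP a) (ρ a)) :
    M.IsStrictEquilibrium (k := k) (fun _ _ => ρ) B ε ν := by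
  intro t i a x h y hy
  have : Nonempty (GroupData m k) := nonempty_of_isProbabilityMeasure (groupLaw B ε k B.prior)
  set σ : StrategyProfile m k K := fun _ _ => ρ
  have harm : Measurable fun w : ℕ → GroupData m k => M.arm σ w t :=
    (M.dependsOn_arm σ t).measurable_of_Iio
  have heval : Measurable fun w : ℕ → GroupData m k => w t := measurable_pi_apply t
  have hY : Measurable fun r : (ℕ → GroupData m k) × ℝ => (r.1 t, r.2) :=
    (heval.comp measurable_fst).prodMk measurable_snd
  have hS : MeasurableSet {w : GroupData m k × ℝ | (w.1 i).signal = x} :=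
    measurable_fst (Set.toFinite {g : GroupData m k | (g i).signal = x}).measurableSet
  have hA : MeasurableSet {r : (ℕ → GroupData m k) × ℝ |
      M.arm σ r.1 t = a ∧ (r.1 t i).signal = x} :=
    ((harm.comp measurable_fst) (measurableSet_singleton a)).inter (hY hS)
  have hpay : ∀ y', ∫ r, M.payment σ r.1 r.2 t i y' ∂ProbabilityTheory.cond
        (runLaw B ε k B.prior ν) {r | M.arm σ r.1 t = a ∧ (r.1 t i).signal = x} =
      ∫ w, ptsPayment M.c w.2 (M.RP a) y' ((w.1 (peer i)).report (ρ a))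
        ∂ProbabilityTheory.cond ((groupLaw B ε k B.prior).prod ν) {w | (w.1 i).signal = x} := by
    intro y'
    have hmeas : Measurable fun w : GroupData m k × ℝ =>
        ptsPayment M.c w.2 (M.RP a) y' ((w.1 (peer i)).report (ρ a)) := by
      have h1 : Measurable fun g : GroupData m k =>
          if y' = (g (peer i)).report (ρ a) then 1 / M.RP a y' else 0 := measurable_of_finite _
      exact ((h1.comp measurable_fst).const_mul _).sub ((measurable_snd.div_const _).const_mul _)
    rw [← M.map_cond_runLaw σ B ε ν B.prior t i a x h,
      integral_map hY.aemeasurable hmeas.aestronglyMeasurable]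
    refine integral_congr_ae ?_
    filter_upwards [ae_cond_mem hA] with r hr
    simp only [payment, reports, hr.1, σ]
  rw [hpay, hpay]
  exact hρ a i x y hy

end AdaPTS

/-! ### The regret of UCB1 -/

/-- An event occurs at most `ℓ + 1` times while it has occurred at most `ℓ` times before. -/
theorem occurrences_le_add_sum {G : Type*} (A : ℕ → (ℕ → G) → Prop) {ℓ : ℝ} (hℓ : 0 ≤ ℓ) (T : ℕ)
    (w : ℕ → G) :
    (occurrences A T w : ℝ) ≤ ℓ + 1 + ∑ t ∈ Finset.range T,
      {w | A t w ∧ ℓ < occurrences A t w}.indicator 1 w := by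
  classical
  induction T with
  | zero => simp [occurrences]; linarith
  | succ T ih =>
    have hstep : occurrences A (T + 1) w = occurrences A T w + if A T w then 1 else 0 := by
      simp only [occurrences, Finset.sum_range_succ]
    rw [hstep, Finset.sum_range_succ]
    have hnn : 0 ≤ ∑ t ∈ Finset.range T,
        {w | A t w ∧ ℓ < occurrences A t w}.indicator (1 : (ℕ → G) → ℝ) w :=
      Finset.sum_nonneg fun t _ => Set.indicator_nonneg (fun _ _ => zero_le_one) _
    by_cases hA : A T w
    · by_cases hN : ℓ < occurrences A T w
      · simp only [hA, hN, if_true, Set.indicator_apply, Set.mem_ofPred_eq, and_self, Pi.one_apply]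
          at ih ⊢
        push_cast
        linarith
      · simp only [hA, hN, if_true, Set.indicator_apply, Set.mem_ofPred_eq, and_false, if_false]
          at hnn ⊢
        push_cast
        linarith [not_lt.1 hN]
    · simp only [hA, if_false, Set.indicator_apply, Set.mem_ofPred_eq, false_and, add_zero] at ih ⊢
      exact ih

namespace AdaPTS

variable {m k K : ℕ} (M : AdaPTS m K) (ρ : Fin K → Fin m → Fin m)

/-- The event that the `a`-th distribution is in force in period `t`, if rational agents apply `ρ a`
whenever it is. -/
def armEvent (a : Fin K) (t : ℕ) (w : ℕ → GroupData m k) : Prop :=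
  M.arm (fun _ _ => ρ) w t = a

theorem dependsOn_armEvent (a : Fin K) (t : ℕ) :
    DependsOn (M.armEvent (k := k) ρ a t) (Set.Iio t) := by
  intro w w' h
  have := M.dependsOn_arm (k := k) (fun _ _ => ρ) t h
  simp only [armEvent]
  exact congrArg (· = a) this

theorem stats_eq (w : ℕ → GroupData m k) (t : ℕ) :
    M.stats (fun _ _ => ρ) w t =
      (fun a => collected (M.armEvent ρ a) (groupDisagreement (ρ a)) t w,
        fun a => occurrences (M.armEvent ρ a) t w) := by
  classical
  induction t with
  | zero => ext <;> simp [stats, collected, occurrences]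
  | succ t ih =>
    have harm : M.arm (fun _ _ => ρ) w t = M.choice t (M.stats (fun _ _ => ρ) w t) := rfl
    rw [stats, ← harm]
    refine Prod.ext (funext fun a => ?_) (funext fun a => ?_)
    · simp only [collected, Finset.sum_range_succ]
      by_cases h : a = M.arm (fun _ _ => ρ) w t
      · have hA : M.armEvent ρ a t w := h.symm
        rw [if_pos hA, ← h, Function.update_self, ih]
        rfl
      · have hA : ¬ M.armEvent ρ a t w := fun h' => h h'.symm
        rw [if_neg hA, Function.update_of_ne h, ih, add_zero]
        rfl
    · simp only [occurrences, Finset.sum_range_succ]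
      by_cases h : a = M.arm (fun _ _ => ρ) w t
      · have hA : M.armEvent ρ a t w := h.symm
        rw [if_pos hA, ← h, Function.update_self, ih]
        rfl
      · have hA : ¬ M.armEvent ρ a t w := fun h' => h h'.symm
        rw [if_neg hA, Function.update_of_ne h, ih, add_zero]
        rfl

theorem armEvent_iff_of_lt {t : ℕ} (ht : t < K) (a : Fin K) (w : ℕ → GroupData m k) :
    M.armEvent ρ a t w ↔ t = a := by
  rw [armEvent, arm, choice, dif_pos ht, Fin.ext_iff]

theorem occurrences_armEvent_pos {t : ℕ} (ht : K ≤ t) (a : Fin K) (w : ℕ → GroupData m k) :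
    0 < occurrences (M.armEvent ρ a) t w := by
  classical
  have ha : (a : ℕ) ∈ Finset.range t := Finset.mem_range.2 (a.2.trans_le ht)
  have h := Finset.single_le_sum (f := fun s => if M.armEvent ρ a s w then 1 else 0)
    (fun s _ => Nat.zero_le _) ha
  simp only [(M.armEvent_iff_of_lt ρ a.2 a w).2 rfl, if_true] at h
  exact h

theorem occurrences_armEvent_eq_zero {t : ℕ} (ht : t < K) {a : Fin K} {w : ℕ → GroupData m k}
    (h : M.armEvent ρ a t w) : occurrences (M.armEvent ρ a) t w = 0 := by
  classical
  refine Finset.sum_eq_zero fun s hs => if_neg fun h' => ?_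
  have hs' := Finset.mem_range.1 hs
  have h1 := (M.armEvent_iff_of_lt ρ ht a w).1 h
  have h2 := (M.armEvent_iff_of_lt ρ (hs'.trans ht) a w).1 h'
  omega

/-- The event that the sum that `f` collects over the uses of the distribution `a` is at least the
confidence radius of UCB1 times the number of uses. -/
def deviation (a : Fin K) (f : GroupData m k → ℝ) (t : ℕ) : Set (ℕ → GroupData m k) :=
  {w | 0 < occurrences (M.armEvent ρ a) t w ∧ occurrences (M.armEvent ρ a) t w *
    √(2 * Real.log t / occurrences (M.armEvent ρ a) t w) ≤ collected (M.armEvent ρ a) f t w}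

/-- If an inferior distribution `a` is chosen after many uses, then its disagreements or those of
the superior distribution `b` deviate from their means by at least the confidence radius. -/
theorem mem_deviation_of_armEvent {a b : Fin K} {μa μb : ℝ} (hlt : μa < μb) {t : ℕ}
    {ℓ : ℝ} (hℓ0 : 0 ≤ ℓ) (hℓ : 8 * Real.log t / (μb - μa) ^ 2 ≤ ℓ) {w : ℕ → GroupData m k}
    (hw : M.armEvent ρ a t w) (hN : ℓ < occurrences (M.armEvent ρ a) t w) :
    w ∈ M.deviation ρ a (fun g => groupDisagreement (ρ a) g - μa) t ∨
      w ∈ M.deviation ρ b (fun g => -(groupDisagreement (ρ b) g - μb)) t := by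
  have hK : K ≤ t := by
    by_contra h
    rw [M.occurrences_armEvent_eq_zero ρ (not_le.1 h) hw] at hN
    simp only [Nat.cast_zero] at hN
    linarith
  have hNa := M.occurrences_armEvent_pos ρ hK a w
  have hNb := M.occurrences_armEvent_pos ρ hK b w
  by_contra hcon
  rw [not_or] at hcon
  obtain ⟨h1, h2⟩ := hcon
  have h1' := lt_of_not_ge fun h => h1 ⟨hNa, h⟩
  have h2' := lt_of_not_ge fun h => h2 ⟨hNb, h⟩
  rw [collected_sub_const] at h1'
  rw [collected_neg, collected_sub_const] at h2'
  have hchoice : M.choice t (M.stats (fun _ _ => ρ) w t) = a := hw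
  rw [choice, dif_neg (not_lt.2 hK), stats_eq] at hchoice
  have hmax := M.le_argmax (fun a => collected (M.armEvent ρ a) (groupDisagreement (ρ a)) t w /
      occurrences (M.armEvent ρ a) t w +
    √(2 * Real.log t / occurrences (M.armEvent ρ a) t w)) b
  rw [hchoice] at hmax
  have hNa' : (0 : ℝ) < occurrences (M.armEvent ρ a) t w := by exact_mod_cast hNa
  have hNb' : (0 : ℝ) < occurrences (M.armEvent ρ b) t w := by exact_mod_cast hNb
  set Na : ℝ := (occurrences (M.armEvent ρ a) t w : ℝ)
  set Nb : ℝ := (occurrences (M.armEvent ρ b) t w : ℝ)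
  set Ia := collected (M.armEvent ρ a) (groupDisagreement (ρ a)) t w
  set Ib := collected (M.armEvent ρ b) (groupDisagreement (ρ b)) t w
  set ca := √(2 * Real.log t / Na) with hca
  set cb := √(2 * Real.log t / Nb)
  have h3 : Ia / Na < μa + ca := by
    rw [div_lt_iff₀ hNa']; linarith
  have h4 : μb - cb < Ib / Nb := by
    rw [lt_div_iff₀ hNb']; linarith
  have h5 : μb - μa < 2 * ca := by linarith
  have hgap : 0 < μb - μa := sub_pos.2 hlt
  have hlog : 0 ≤ Real.log t := Real.log_natCast_nonneg t
  have h6 : (μb - μa) ^ 2 < (2 * ca) ^ 2 := pow_lt_pow_left₀ h5 hgap.le two_ne_zero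
  have hca2 : ca ^ 2 = 2 * Real.log t / Na := Real.sq_sqrt (by positivity)
  rw [mul_pow, hca2] at h6
  have h7 : (μb - μa) ^ 2 * Na < 8 * Real.log t := by
    have := mul_lt_mul_of_pos_right h6 hNa'
    have e : 2 ^ 2 * (2 * Real.log t / Na) * Na = 8 * Real.log t := by
      rw [mul_assoc, div_mul_cancel₀ _ hNa'.ne']; ring
    linarith
  have h8 : Na < 8 * Real.log t / (μb - μa) ^ 2 := by
    rw [lt_div_iff₀ (by positivity)]; linarith
  linarith

theorem measurableSet_deviation [Nonempty (GroupData m k)] (a : Fin K) (f : GroupData m k → ℝ)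
    (t : ℕ) : MeasurableSet (M.deviation ρ a f t) := by
  refine measurableSet_setOfPred.2 (DependsOn.measurable_of_Iio (n := t) fun w w' h => ?_)
  rw [dependsOn_occurrences (M.dependsOn_armEvent ρ a) t h,
    dependsOn_collected (M.dependsOn_armEvent ρ a) f t h]

variable (γ : Measure (GroupData m k)) [IsProbabilityMeasure γ]

theorem measureReal_deviation_le (a : Fin K) {f : GroupData m k → ℝ} {r : ℝ}
    (hf : ∀ g, f g ∈ Set.Icc r (r + 1)) (hmean : ∫ g, f g ∂γ = 0) (t : ℕ) :
    (Measure.infinitePi fun _ : ℕ => γ).real (M.deviation ρ a f t) ≤ 1 / (t : ℝ) ^ 3 :=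
  _root_.measureReal_deviation_le γ (M.dependsOn_armEvent ρ a) hf hmean t

/-- The UCB1 bound: the expected number of uses of an inferior distribution is logarithmic. -/
theorem integral_occurrences_le (hk : 2 ≤ k) {a b : Fin K}
    (hlt : ∫ g, groupDisagreement (ρ a) g ∂γ < ∫ g, groupDisagreement (ρ b) g ∂γ) (T : ℕ) :
    ∫ w, (occurrences (M.armEvent ρ a) T w : ℝ) ∂(Measure.infinitePi fun _ : ℕ => γ) ≤
      8 * Real.log T /
        (∫ g, groupDisagreement (ρ b) g ∂γ - ∫ g, groupDisagreement (ρ a) g ∂γ) ^ 2 +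
        (1 + 2 * ∑' t : ℕ, 1 / (t : ℝ) ^ 3) := by
  have : Nonempty (GroupData m k) := nonempty_of_isProbabilityMeasure γ
  set μ := Measure.infinitePi fun _ : ℕ => γ
  set μa := ∫ g, groupDisagreement (ρ a) g ∂γ with hμa
  set μb := ∫ g, groupDisagreement (ρ b) g ∂γ with hμb
  set ℓ := 8 * Real.log T / (μb - μa) ^ 2 with hℓ
  have hlogT : 0 ≤ Real.log T := Real.log_natCast_nonneg T
  have hℓ0 : 0 ≤ ℓ := by positivity
  set fa : GroupData m k → ℝ := fun g => groupDisagreement (ρ a) g - μa with hfa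
  set fb : GroupData m k → ℝ := fun g => -(groupDisagreement (ρ b) g - μb) with hfb
  have hpoint : ∀ w, (occurrences (M.armEvent ρ a) T w : ℝ) ≤ ℓ + 1 + ∑ t ∈ Finset.range T,
      ((M.deviation ρ a fa t).indicator 1 w + (M.deviation ρ b fb t).indicator 1 w) := by
    intro w
    refine (occurrences_le_add_sum (M.armEvent ρ a) hℓ0 T w).trans ?_
    refine add_le_add_right (Finset.sum_le_sum fun t ht => ?_) _
    have hn1 : 0 ≤ (M.deviation ρ a fa t).indicator (1 : (ℕ → GroupData m k) → ℝ) w :=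
      Set.indicator_nonneg (fun _ _ => zero_le_one) _
    have hn2 : 0 ≤ (M.deviation ρ b fb t).indicator (1 : (ℕ → GroupData m k) → ℝ) w :=
      Set.indicator_nonneg (fun _ _ => zero_le_one) _
    by_cases hw : w ∈ {w | M.armEvent ρ a t w ∧ ℓ < occurrences (M.armEvent ρ a) t w}
    · rw [Set.indicator_of_mem hw]
      have hlog : Real.log t ≤ Real.log T := by
        rcases Nat.eq_zero_or_pos t with rfl | ht0
        · simpa using hlogT
        · exact Real.log_le_log (by exact_mod_cast ht0)
            (by exact_mod_cast (Finset.mem_range.1 ht).le)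
      have hℓt : 8 * Real.log t / (μb - μa) ^ 2 ≤ ℓ := by
        rw [hℓ]; gcongr
      rcases M.mem_deviation_of_armEvent ρ hlt hℓ0 hℓt hw.1 hw.2 with h | h
      · rw [Set.indicator_of_mem (s := M.deviation ρ a fa t) h]
        simpa using hn2
      · rw [Set.indicator_of_mem (s := M.deviation ρ b fb t) h]
        simpa using hn1
    · rw [Set.indicator_of_notMem hw]
      exact add_nonneg hn1 hn2
  have ha : ∀ g, fa g ∈ Set.Icc (-μa) (-μa + 1) := fun g =>
    ⟨by have := disagreement_nonneg hk fun i => (g i).report (ρ a)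
        simp only [hfa, groupDisagreement]; linarith,
      by have := disagreement_le_one hk fun i => (g i).report (ρ a)
         simp only [hfa, groupDisagreement]; linarith⟩
  have hb : ∀ g, fb g ∈ Set.Icc (μb - 1) (μb - 1 + 1) := fun g =>
    ⟨by have := disagreement_le_one hk fun i => (g i).report (ρ b)
        simp only [hfb, groupDisagreement]; linarith,
      by have := disagreement_nonneg hk fun i => (g i).report (ρ b)
         simp only [hfb, groupDisagreement]; linarith⟩
  have hma : ∫ g, fa g ∂γ = 0 := by
    rw [hfa, integral_sub Integrable.of_finite (integrable_const _), ← hμa]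
    simp
  have hmb : ∫ g, fb g ∂γ = 0 := by
    rw [hfb, integral_neg, integral_sub Integrable.of_finite (integrable_const _), ← hμb]
    simp
  have hia : ∀ t, Integrable ((M.deviation ρ a fa t).indicator (1 : (ℕ → GroupData m k) → ℝ)) μ :=
    fun t => (integrable_const 1).indicator (M.measurableSet_deviation ρ a fa t)
  have hib : ∀ t, Integrable ((M.deviation ρ b fb t).indicator (1 : (ℕ → GroupData m k) → ℝ)) μ :=
    fun t => (integrable_const 1).indicator (M.measurableSet_deviation ρ b fb t)
  have hocc : Integrable (fun w => (occurrences (M.armEvent ρ a) T w : ℝ)) μ :=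
    DependsOn.integrable_infinitePi γ (n := T) fun w w' h => by
      rw [dependsOn_occurrences (M.dependsOn_armEvent ρ a) T h]
  have hiab : ∀ t, Integrable (fun w =>
      (M.deviation ρ a fa t).indicator (1 : (ℕ → GroupData m k) → ℝ) w +
        (M.deviation ρ b fb t).indicator 1 w) μ := fun t => (hia t).add (hib t)
  have hsum : Integrable (fun w => ∑ t ∈ Finset.range T,
      ((M.deviation ρ a fa t).indicator (1 : (ℕ → GroupData m k) → ℝ) w +
        (M.deviation ρ b fb t).indicator 1 w)) μ :=
    integrable_finsetSum _ fun t _ => hiab t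
  have hsummable : Summable fun t : ℕ => 1 / (t : ℝ) ^ 3 :=
    Real.summable_one_div_nat_pow.2 (by norm_num)
  calc ∫ w, (occurrences (M.armEvent ρ a) T w : ℝ) ∂μ
      ≤ ∫ w, (ℓ + 1 + ∑ t ∈ Finset.range T, ((M.deviation ρ a fa t).indicator 1 w +
          (M.deviation ρ b fb t).indicator 1 w)) ∂μ :=
        integral_mono hocc ((integrable_const _).add hsum) hpoint
    _ = ℓ + 1 + ∑ t ∈ Finset.range T,
          (μ.real (M.deviation ρ a fa t) + μ.real (M.deviation ρ b fb t)) := by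
        rw [integral_add (integrable_const _) hsum, integral_finsetSum _ fun t _ => hiab t]
        simp only [integral_const, probReal_univ, one_smul]
        congr 1
        refine Finset.sum_congr rfl fun t _ => ?_
        rw [integral_add (hia t) (hib t),
          integral_indicator_one (M.measurableSet_deviation ρ a fa t),
          integral_indicator_one (M.measurableSet_deviation ρ b fb t)]
    _ ≤ ℓ + 1 + ∑ t ∈ Finset.range T, (1 / (t : ℝ) ^ 3 + 1 / (t : ℝ) ^ 3) :=
        add_le_add_right (Finset.sum_le_sum fun t _ => add_le_add
          (M.measureReal_deviation_le ρ γ a ha hma t)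
          (M.measureReal_deviation_le ρ γ b hb hmb t)) _
    _ ≤ ℓ + (1 + 2 * ∑' t : ℕ, 1 / (t : ℝ) ^ 3) := by
        have := hsummable.sum_le_tsum (Finset.range T) fun t _ => by positivity
        rw [Finset.sum_add_distrib]
        linarith

/-! ### The number of non-truthful reports -/

theorem numNonTruthful_le (w : ℕ → GroupData m k) (T : ℕ) :
    M.numNonTruthful (fun _ _ => ρ) w T ≤
      k * ∑ a ∈ Finset.univ.filter (fun a => ρ a ≠ id), occurrences (M.armEvent ρ a) T w := by
  classical
  simp only [occurrences]
  rw [Finset.sum_comm, Finset.mul_sum]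
  refine Finset.sum_le_sum fun t _ => ?_
  by_cases h : ρ (M.arm (fun _ _ => ρ) w t) = id
  · refine le_of_eq_of_le (Finset.card_eq_zero.2 ?_) (Nat.zero_le _)
    refine Finset.filter_eq_empty_iff.2 fun i _ hi => hi.2 ?_
    simp [reports, h, AgentData.report, hi.1]
  · have h1 : 1 ≤ ∑ a ∈ Finset.univ.filter (fun a => ρ a ≠ id),
        if M.armEvent ρ a t w then 1 else 0 := by
      refine le_trans ?_ (Finset.single_le_sum (fun a _ => Nat.zero_le _)
        (Finset.mem_filter.2 ⟨Finset.mem_univ (M.arm (fun _ _ => ρ) w t), h⟩))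
      rw [if_pos (show M.armEvent ρ _ t w from rfl)]
    calc _ ≤ (Finset.univ : Finset (Fin k)).card := Finset.card_le_card (Finset.filter_subset _ _)
      _ = k * 1 := by simp
      _ ≤ _ := Nat.mul_le_mul_left k h1

/-- Non-truthful reports occur only while an untruthful distribution is in force, so if each of
these disagrees less than the distribution `b`, their expected number is logarithmic. -/
theorem exists_expectedNonTruthful_le (B : BeliefModel m) (ε : Set.Ico (0 : ℝ) 1) (ν : Measure ℝ)
    [IsProbabilityMeasure ν] (hk : 2 ≤ k) (q : Measure B.Ω) [IsProbabilityMeasure q] {b : Fin K}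
    (hlt : ∀ a, ρ a ≠ id → ∫ g, groupDisagreement (ρ a) g ∂groupLaw B ε k q <
      ∫ g, groupDisagreement (ρ b) g ∂groupLaw B ε k q) :
    ∃ C : ℝ, ∀ T : ℕ,
      M.expectedNonTruthful (k := k) (fun _ _ => ρ) B ε q ν T ≤ C * Real.log (k * T) := by
  classical
  set γ := groupLaw B ε k q
  set μ := Measure.infinitePi fun _ : ℕ => γ with hμ
  set Z : ℝ := 1 + 2 * ∑' t : ℕ, 1 / (t : ℝ) ^ 3 with hZ
  have hZ0 : 0 ≤ Z := by
    have : 0 ≤ ∑' t : ℕ, 1 / (t : ℝ) ^ 3 := tsum_nonneg fun t => by positivity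
    positivity
  set gap : Fin K → ℝ := fun a =>
    ∫ g, groupDisagreement (ρ b) g ∂γ - ∫ g, groupDisagreement (ρ a) g ∂γ with hgap
  set bad : Finset (Fin K) := Finset.univ.filter fun a => ρ a ≠ id with hbad
  refine ⟨k * ∑ a ∈ bad, (8 / gap a ^ 2 + Z / Real.log 2), fun T => ?_⟩
  have hexp : M.expectedNonTruthful (k := k) (fun _ _ => ρ) B ε q ν T =
      ∫ w, (M.numNonTruthful (fun _ _ => ρ) w T : ℝ) ∂μ := by
    rw [expectedNonTruthful, runLaw,
      integral_fun_fst fun w : ℕ → GroupData m k => (M.numNonTruthful (fun _ _ => ρ) w T : ℝ)]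
    simp [hμ, γ]
  rw [hexp]
  rcases Nat.eq_zero_or_pos T with rfl | hT
  · simp [numNonTruthful]
  have hT' : (1 : ℝ) ≤ T := by exact_mod_cast hT
  have hk' : (2 : ℝ) ≤ k := by exact_mod_cast hk
  have hlog2 : 0 < Real.log 2 := Real.log_pos (by norm_num)
  have hl1 : Real.log T ≤ Real.log (k * T) := Real.log_le_log (by linarith) (by nlinarith)
  have hl2 : Real.log 2 ≤ Real.log (k * T) := Real.log_le_log (by norm_num) (by nlinarith)
  have hocc : ∀ a, Integrable (fun w => (occurrences (M.armEvent ρ a) T w : ℝ)) μ := fun a =>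
    DependsOn.integrable_infinitePi γ (n := T) fun w w' h => by
      rw [dependsOn_occurrences (M.dependsOn_armEvent ρ a) T h]
  have hnum : Integrable (fun w => (M.numNonTruthful (fun _ _ => ρ) w T : ℝ)) μ := by
    refine DependsOn.integrable_infinitePi γ (n := T) fun w w' h => ?_
    have : M.numNonTruthful (fun _ _ => ρ) w T = M.numNonTruthful (fun _ _ => ρ) w' T := by
      refine Finset.sum_congr rfl fun t ht => ?_
      have ht' := Finset.mem_range.1 ht
      have h1 : M.arm (fun _ _ => ρ) w t = M.arm (fun _ _ => ρ) w' t :=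
        (M.dependsOn_arm (k := k) (fun _ _ => ρ) t).mono_Iio ht'.le h
      simp only [reports, h1, h t ht']
      congr!
    rw [this]
  calc ∫ w, (M.numNonTruthful (fun _ _ => ρ) w T : ℝ) ∂μ
      ≤ ∫ w, k * ∑ a ∈ bad, (occurrences (M.armEvent ρ a) T w : ℝ) ∂μ :=
        integral_mono hnum ((integrable_finsetSum _ fun a _ => hocc a).const_mul _) fun w => by
          simpa using (Nat.cast_le (α := ℝ)).2 (M.numNonTruthful_le ρ w T)
    _ = k * ∑ a ∈ bad, ∫ w, (occurrences (M.armEvent ρ a) T w : ℝ) ∂μ := by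
        rw [integral_const_mul, integral_finsetSum _ fun a _ => hocc a]
    _ ≤ k * ∑ a ∈ bad, (8 / gap a ^ 2 + Z / Real.log 2) * Real.log (k * T) := by
        refine mul_le_mul_of_nonneg_left (Finset.sum_le_sum fun a ha => ?_) (by positivity)
        refine (M.integral_occurrences_le ρ γ hk (hlt a (Finset.mem_filter.1 ha).2) T).trans ?_
        rw [add_mul]
        refine add_le_add ?_ ?_
        · rw [mul_div_right_comm]
          exact mul_le_mul_of_nonneg_left hl1 (by positivity)
        · rw [div_mul_eq_mul_div, le_div_iff₀ hlog2]
          exact mul_le_mul_of_nonneg_left hl2 hZ0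
    _ = _ := by rw [← Finset.sum_mul, mul_assoc]

end AdaPTS

/-! ### The equilibrium of the adaptive mechanism -/

theorem mainTheorem2 {m k : ℕ} (hk : 2 ≤ k) (B : BeliefModel m) (hB : B.StochasticallyRelevant)
    (ε : Set.Ico (0 : ℝ) 1) :
    -- every fine enough discretization contains a distribution for which PTS is BNIC
    (∃ γ₀ : ℝ, 0 < γ₀ ∧ ∀ (K : ℕ) (RP : Fin K → Fin m → ℝ), IsDiscretization γ₀ RP →
      ∃ a : Fin K, ∀ (ν : Measure ℝ) [IsProbabilityMeasure ν] (c : ℝ), Integrable id ν →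
        ∫ e, e ∂ν = (ε : ℝ) → 0 < c → IsBNIC B ε k ν c (RP a)) ∧
    -- whenever there is such a distribution, AdaPTS has the claimed equilibrium
    ∀ (ν : Measure ℝ) [IsProbabilityMeasure ν], Integrable id ν → ∫ e, e ∂ν = (ε : ℝ) →
      ∀ {K : ℕ} (M : AdaPTS m K), (∃ a, IsBNIC B ε k ν M.c (M.RP a)) →
        ∃ σ : StrategyProfile m k K,
          M.TruthfulOrNonSurjective σ B ε ν ∧
          M.IsStrictEquilibrium σ B ε ν ∧
          (∃ C : ℝ, ∀ T : ℕ,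
            M.expectedNonTruthful σ B ε B.prior ν T ≤ C * Real.log (k * T)) ∧
          -- the bound also holds conditionally on any one state that all groups share
          ∀ ω : B.Ω, ∃ C : ℝ, ∀ T : ℕ,
            M.expectedNonTruthful σ B ε (Measure.dirac ω) ν T ≤ C * Real.log (k * T) := by
  classical
  refine ⟨exists_granularity B ε hk hB, fun ν _ hν hmean K M ⟨b, hb⟩ => ?_⟩
  obtain ⟨ω₀⟩ : Nonempty B.Ω := nonempty_of_isProbabilityMeasure B.prior
  let z₀ : Fin m := ⟨0, B.signals_pos ω₀⟩
  let ρ : Fin K → Fin m → Fin m := fun a =>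
    if IsBNIC B ε k ν M.c (M.RP a) then id else fun _ => z₀
  have hpos : ∀ a, IsBNIC B ε k ν M.c (M.RP a) → ρ a = id := fun a h => if_pos h
  have hneg : ∀ a, ¬ IsBNIC B ε k ν M.c (M.RP a) → ρ a = fun _ => z₀ := fun a h => if_neg h
  -- with fewer than two signals there is no report to deviate to
  have htwo : ∀ a, ¬ IsBNIC B ε k ν M.c (M.RP a) → 2 ≤ m := by
    intro a h
    by_contra hm
    refine h fun i x y hy => (hy ?_).elim
    have : Subsingleton (Fin m) := Fin.subsingleton_iff_le_one.2 (by omega)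
    exact Subsingleton.elim _ _
  have hconst : ∀ a, IsStrictPTSEquilibrium B ε k ν M.c (M.RP a) (fun _ => z₀) := fun a =>
    isStrictPTSEquilibrium_const B ε hk hν hmean M.c_pos (M.fullyMixed a) z₀
  have hgap : ∀ (q : Measure B.Ω) [IsProbabilityMeasure q] (a : Fin K), ρ a ≠ id →
      ∫ g, groupDisagreement (ρ a) g ∂groupLaw B ε k q <
        ∫ g, groupDisagreement (ρ b) g ∂groupLaw B ε k q := by
    intro q _ a ha
    have hna : ¬ IsBNIC B ε k ν M.c (M.RP a) := fun h => ha (hpos a h)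
    rw [hneg a hna, hpos b hb]
    exact integral_groupDisagreement_const_lt B ε hk (htwo a hna) q z₀
  refine ⟨fun _ _ => ρ, fun a => ⟨fun h t i => hpos a h, fun h =>
      ⟨fun _ => z₀, ?_, hconst a, fun t i => hneg a h⟩⟩,
    M.isStrictEquilibrium_of_forall B ε ν ρ fun a => ?_,
    M.exists_expectedNonTruthful_le ρ B ε ν hk B.prior (hgap B.prior),
    fun ω => M.exists_expectedNonTruthful_le ρ B ε ν hk (Measure.dirac ω) (hgap _)⟩
  · intro hsurj
    have : Nontrivial (Fin m) := Fin.nontrivial_iff_two_le.2 (htwo a h)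
    obtain ⟨z, hz⟩ := exists_ne z₀
    obtain ⟨x, hx⟩ := hsurj z
    exact hz hx.symm
  · by_cases h : IsBNIC B ε k ν M.c (M.RP a)
    · rw [hpos a h]
      exact h
    · rw [hneg a h]
      exact hconst a
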